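/- Let $n,k$ be integers with $1\le k<n+1$, put $Q=2n+2$ and $p=\frac{2Q}{Q-2k}$, and let $S^{2n+1}\subset\mathbb{C}^{n+1}$ be the unit sphere with its standard CR structure, the contact form $\theta_0=\frac i2\sum_{j=1}^{n+1}(z_j\,d\bar z_j-\bar z_j\,dz_j)$, the volume element $d\xi=\theta_0\wedge(d\theta_0)^n$ (that is, $2^n n!$ times the surface measure) and the Reeb field $T=i\sum_j(z_j\partial_{z_j}-\bar z_j\partial_{\bar z_j})$. With $Z_{jl}=\bar z_j\partial_{z_l}-\bar z_l\partial_{z_j}$ (these fields span $T^{1,0}S^{2n+1}$), let $\Delta_b=-\sum_{j<l}(Z_{jl}\bar Z_{jl}+\bar Z_{jl}Z_{jl})$ be the sub-Laplacian, and let $$P_k=\prod_{j=0}^{k-1}L_{k-2j-1},\qquad L_\mu=\tfrac12\Delta_b+\tfrac i2\mu T+\tfrac14(n-\mu)(n+\mu),$$ be the CR GJMS operator of order $2k$ of $(S^{2n+1},\theta_0)$. Let $S^{k,2}(S^{2n+1})$ be the Folland--Stein space, the closure of $C^\infty(S^{2n+1};\mathbb{C})$ in the norm $\sum\|X_1\cdots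 X_mF\|_{L^2}$, where the sum is over all $m\le k$ and all choices of $X_1,\dots,X_m$ among the fields $Z_{jl},\bar Z_{jl}$. For $F,G\in S^{k,2}(S^{2n+1})$ the expression $\int G\,P_kF\,d\xi$ denotes the continuous extension to $S^{k,2}\times S^{k,2}$ of the bilinear form $(\varphi,\psi)\mapsto\int\psi\,P_k\varphi\,d\xi$ on smooth functions, and for smooth $a$ $$\int G\,[P_k,a](F)\,d\xi:=\int G\,P_k(aF)\,d\xi-\int aG\,P_kF\,d\xi .$$ Let $u\in S^{k,2}(S^{2n+1};\mathbb{R})$ be positive almost everywhere and a local minimizer of $$Y_k(S^{2n+1})=\inf\Big\{\int v\,P_kv\,d\xi\;:\;v\in S^{k,2}(S^{2n+1};\mathbb{R}),\ \int|v|^p\,d\xi=1\Big\};$$ that is, $\int u^p\,d\xi=1$, and there is $\varepsilon>0$ such that $\int u\,P_ku\,d\xi\le\int v\,P_kv\,d\xi$ for all real-valued $v\in S^{k,2}(S^{2n+1})$ with $\int|v|^p\,d\xi=1$ and $\|v-u\|_{S^{k,2}}<\varepsilon$. (In particular, this holds if $u$ is a local minimizer among complex-valued functions.) Suppose in addition that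 $$\int_{S^{2n+1}}z_j\,u^p\,d\xi=0,\qquad j=1,\dots,n+1 .$$ Then $\sum_{j}\int\bar z_ju\,[P_k,z_j](u)\,d\xi$ and $\int u\,P_k(u)\,d\xi$ are real numbers, and $$\sum_{j=1}^{n+1}\int_{S^{2n+1}}\bar z_j\,u\,[P_k,z_j](u)\,d\xi\;\ge\;(p-2)\int_{S^{2n+1}}u\,P_k(u)\,d\xi .$$ -/

import Mathlib

open MeasureTheory Filter Topology
open scoped ENNReal ContDiff

noncomputable section

namespace CRSphere

/-- `ℂ^{n+1}` with its Hermitian norm. -/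
abbrev Amb (n : ℕ) : Type := EuclideanSpace ℂ (Fin (n + 1))

/-- The unit sphere `S^{2n+1} ⊆ ℂ^{n+1}`. -/
abbrev Sph (n : ℕ) : Type := Metric.sphere (0 : Amb n) 1

/-- The coordinate function `z_j` on the sphere. -/
def coord {n : ℕ} (j : Fin (n + 1)) (ξ : Sph n) : ℂ := (ξ : Amb n) j

/-- The volume element `dξ = θ₀ ∧ (dθ₀)^n` of the contact form
`θ₀ = (i/2) ∑ (z_j dz̄_j - z̄_j dz_j) = ∑ (x_j dy_j - y_j dx_j)`. Since `dθ₀ = 2 ∑ dx_j ∧ dy_j`,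
it is `2^n n!` times the surface measure of the unit sphere. -/
def vol (n : ℕ) : Measure (Sph n) :=
  ((2 ^ n * n.factorial : ℕ) : ℝ≥0∞) • (volume : Measure (Amb n)).toSphere

/-- The extension of a function on the sphere to `ℂ^{n+1} \ {0}` that is constant on rays
(the value at the origin plays no role). -/
def radialExt {n : ℕ} (f : Sph n → ℂ) (z : Amb n) : ℂ :=
  if h : z = 0 then 0
  else f ⟨((‖z‖⁻¹ : ℝ) : ℂ) • z, by
    rw [mem_sphere_zero_iff_norm, norm_smul, Complex.norm_real, norm_inv, norm_norm]
    exact inv_mul_cancel₀ (norm_ne_zero_iff.mpr h)⟩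

/-- `f ∈ C^∞(S^{2n+1}; ℂ)`. -/
def IsSmooth {n : ℕ} (f : Sph n → ℂ) : Prop :=
  ContDiffOn ℝ ∞ (radialExt f) {0}ᶜ

/-- The derivative of `f` at `ξ` in the direction of the real tangent vector `v`. -/
def dirDeriv {n : ℕ} (f : Sph n → ℂ) (ξ : Sph n) (v : Amb n) : ℂ :=
  fderiv ℝ (radialExt f) (ξ : Amb n) v

/-- The coefficient vector `z̄_j e_l - z̄_l e_j` of the vector field
`Z_{jl} = z̄_j ∂_{z_l} - z̄_l ∂_{z_j}`. -/
def horizVec {n : ℕ} (j l : Fin (n + 1)) (ξ : Sph n) : Amb n :=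
  EuclideanSpace.single l (star (coord j ξ)) - EuclideanSpace.single j (star (coord l ξ))

/-- `Z_{jl} f`, where `Z_{jl} = z̄_j ∂_{z_l} - z̄_l ∂_{z_j}`. These tangential fields span the CR
structure `T^{1,0} S^{2n+1}` at every point. For a coefficient vector `a`, one has
`∑ a_m ∂_{z_m} f = (df(a) - i df(i a)) / 2`. -/
def Z {n : ℕ} (j l : Fin (n + 1)) (f : Sph n → ℂ) (ξ : Sph n) : ℂ :=
  (dirDeriv f ξ (horizVec j l ξ) - Complex.I * dirDeriv f ξ (Complex.I • horizVec j l ξ)) / 2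

/-- `Z̄_{jl} f`, where `Z̄_{jl} = z_j ∂_{z̄_l} - z_l ∂_{z̄_j}` is the conjugate of `Z_{jl}`. -/
def Zbar {n : ℕ} (j l : Fin (n + 1)) (f : Sph n → ℂ) (ξ : Sph n) : ℂ :=
  (dirDeriv f ξ (horizVec j l ξ) + Complex.I * dirDeriv f ξ (Complex.I • horizVec j l ξ)) / 2

/-- The Reeb field `T = i ∑ (z_j ∂_{z_j} - z̄_j ∂_{z̄_j})` of `θ₀`, i.e. the derivative in the
direction `i ξ`. -/
def reeb {n : ℕ} (f : Sph n → ℂ) (ξ : Sph n) : ℂ :=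
  dirDeriv f ξ (Complex.I • (ξ : Amb n))

/-- The (nonnegative) sub-Laplacian of `θ₀`,
`Δ_b = -∑_α (Z_α Z̄_α + Z̄_α Z_α) = -∑_{j<l} (Z_{jl} Z̄_{jl} + Z̄_{jl} Z_{jl})`
(`Z_α` a local unitary frame of `T^{1,0}`). The sum below runs over all ordered pairs, whence the
factor `1/2`. -/
def subLaplacian {n : ℕ} (f : Sph n → ℂ) (ξ : Sph n) : ℂ :=
  -(1 / 2) * ∑ j : Fin (n + 1), ∑ l : Fin (n + 1),
    (Z j l (Zbar j l f) ξ + Zbar j l (Z j l f) ξ)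

/-- `L_μ = (1/2) Δ_b + (i/2) μ T + (1/4) (n - μ) (n + μ)`. -/
def Lop {n : ℕ} (μ : ℝ) (f : Sph n → ℂ) (ξ : Sph n) : ℂ :=
  1 / 2 * subLaplacian f ξ + Complex.I / 2 * μ * reeb f ξ
    + 1 / 4 * ((n : ℂ) - μ) * ((n : ℂ) + μ) * f ξ

/-- The CR GJMS operator of order `2k` of `(S^{2n+1}, θ₀)`,
`P_k = ∏_{j=0}^{k-1} L_{k-2j-1}`, acting on smooth functions. -/
def gjms {n : ℕ} (k : ℕ) (f : Sph n → ℂ) : Sph n → ℂ :=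
  (List.range k).foldr (fun j g => Lop ((k : ℝ) - 2 * j - 1) g) f

/-- Labels of the horizontal fields `Z_{jl}` (`false`) and `Z̄_{jl}` (`true`). -/
abbrev Label (n : ℕ) : Type := Fin (n + 1) × Fin (n + 1) × Bool

/-- The horizontal field with a given label. -/
def horiz {n : ℕ} (a : Label n) (f : Sph n → ℂ) : Sph n → ℂ :=
  if a.2.2 then Zbar a.1 a.2.1 f else Z a.1 a.2.1 f

/-- `X_{a_1} ⋯ X_{a_m} f` for a word `a_1 ⋯ a_m` of horizontal fields. -/
def horizWord {n : ℕ} (w : List (Label n)) (f : Sph n → ℂ) : Sph n → ℂ :=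
  w.foldr horiz f

/-- `G ∈ L²` is the weak derivative `X_{a_1} ⋯ X_{a_m} F` of `F ∈ L²`. All the fields are
divergence free for `dξ`, so the formal transpose of `X_{a_1} ⋯ X_{a_m}` is
`(-1)^m X_{a_m} ⋯ X_{a_1}`. -/
def IsWeakDeriv {n : ℕ} (w : List (Label n)) (F G : Sph n → ℂ) : Prop :=
  MemLp F 2 (vol n) ∧ MemLp G 2 (vol n) ∧
    ∀ φ : Sph n → ℂ, IsSmooth φ →
      ∫ ξ, G ξ * φ ξ ∂(vol n) = (-1) ^ w.length * ∫ ξ, F ξ * horizWord w.reverse φ ξ ∂(vol n)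

/-- The Folland–Stein norm `‖F‖_{S^{k,2}} = ∑_{m ≤ k} ∑_{a_1, …, a_m} ‖X_{a_1} ⋯ X_{a_m} F‖_{L²}`,
with weak derivatives. It is `∞` if one of them does not exist in `L²`; the infimum is over the
(almost everywhere unique) weak derivatives. -/
def fsNorm {n : ℕ} (k : ℕ) (F : Sph n → ℂ) : ℝ≥0∞ :=
  ∑ m ∈ Finset.range (k + 1), ∑ a : Fin m → Label n,
    ⨅ (G : Sph n → ℂ) (_ : IsWeakDeriv (List.ofFn a) F G), eLpNorm G 2 (vol n)

/-- `F ∈ S^{k,2}(S^{2n+1})`, the closure of `C^∞` for the Folland–Stein norm. -/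
def MemFS {n : ℕ} (k : ℕ) (F : Sph n → ℂ) : Prop :=
  ∀ ε : ℝ≥0∞, 0 < ε → ∃ φ : Sph n → ℂ, IsSmooth φ ∧ fsNorm k (φ - F) < ε

/-- Smooth functions converging to `F` in `S^{k,2}`. -/
def smoothNhds {n : ℕ} (k : ℕ) (F : Sph n → ℂ) : Filter (Sph n → ℂ) :=
  ⨅ (ε : ℝ≥0∞) (_ : 0 < ε), 𝓟 {φ | IsSmooth φ ∧ fsNorm k (φ - F) < ε}

/-- `⟨P_k F, G⟩ = ∫ G P_k F dξ` for `F, G ∈ S^{k,2}`: the continuous extension to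
`S^{k,2} × S^{k,2}` of the bilinear form `(φ, ψ) ↦ ∫ ψ P_k φ dξ` on smooth functions.
In other words, `P_k F` is taken in the dual of `S^{k,2}`. -/
def gjmsPairing {n : ℕ} (k : ℕ) (F G : Sph n → ℂ) : ℂ :=
  limUnder (smoothNhds k F ×ˢ smoothNhds k G)
    fun q : (Sph n → ℂ) × (Sph n → ℂ) => ∫ ξ, q.2 ξ * gjms k q.1 ξ ∂(vol n)

/-- `∫ G [P_k, a] F dξ` for a smooth function `a`, where `[P_k, a] F = P_k (a F) - a P_k F`. -/
def commPairing {n : ℕ} (k : ℕ) (a F G : Sph n → ℂ) : ℂ :=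
  gjmsPairing k (a * F) G - gjmsPairing k F (a * G)

/-- `p = 2Q / (Q - 2k)` with `Q = 2n + 2`. -/
def critExp (n k : ℕ) : ℝ := 2 * (2 * n + 2) / ((2 * n + 2) - 2 * k)

/-- A real-valued function regarded as a complex-valued one. -/
def toC {n : ℕ} (u : Sph n → ℝ) (ξ : Sph n) : ℂ := (u ξ : ℂ)

/-- `A_k(u) = ∫ u P_k u dξ` for real-valued `u ∈ S^{k,2}` (a real number, as `P_k` is formally
self-adjoint). -/
def energy {n : ℕ} (k : ℕ) (u : Sph n → ℝ) : ℝ := (gjmsPairing k (toC u) (toC u)).re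

/-- `B_k(u) = ∫ |u|^p dξ`. -/
def constraint {n : ℕ} (k : ℕ) (u : Sph n → ℝ) : ℝ := ∫ ξ, |u ξ| ^ critExp n k ∂(vol n)

/-- `u` is a local minimizer of `Y_k(S^{2n+1})`: it minimizes `A_k` among the real-valued
`v ∈ S^{k,2}` with `B_k(v) = 1` that are close to `u` in `S^{k,2}`, and `B_k(u) = 1`. -/
def IsLocalMinimizer {n : ℕ} (k : ℕ) (u : Sph n → ℝ) : Prop :=
  MemFS k (toC u) ∧ constraint k u = 1 ∧
    ∃ ε : ℝ≥0∞, 0 < ε ∧ ∀ v : Sph n → ℝ, MemFS k (toC v) → constraint k v = 1 →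
      fsNorm k (toC v - toC u) < ε → energy k u ≤ energy k v

end CRSphere

end

/-!
Write `p` for the critical exponent, and normalize the variation `u + t f u` of a local minimizer
`u`: if `f` is real, smooth and `∫ f |u|^p = 0`, then
`∫ |1 + t f|^p |u|^p = 1 + p (p - 1) / 2 t² ∫ f² |u|^p + o(t²)`, so comparing the coefficients of
`t²` in `A(u) (∫ |u + t f u|^p)^(2/p) ≤ A(u + t f u)`, where `A(v) = ∫ v P_k v`, gives
`(p - 1) (∫ f² |u|^p) A(u) ≤ A(f u)`. Apply this to the real and imaginary parts of functions `b_j`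
with `∑ |b_j|² = 1`, such as the coordinates. Since `P_k` is symmetric, the left-hand sides add up
to `(p - 1) A(u)` and the right-hand sides to `∑ ∫ b̄_j u P_k (b_j u)`, which exceeds
`∑ ∫ b̄_j u [P_k, b_j] u` by `A(u)`.

That the pairing extends to the Folland–Stein space, symmetrically and compatibly with complex
conjugation, rests on three facts. The vector fields are complex combinations of derivatives along
skew-symmetric linear fields, whose flows preserve the volume, so they are antisymmetric.
Transposition and conjugation exchange `L_μ` and `L_{-μ}`, hence permute the factors of `P_k`, which
commute because the Reeb field commutes with the sub-Laplacian. Finally, for `n ≠ 0` the Reeb field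
is a combination of commutators `[Z_{jl}, Z̄_{jl}]`, so `P_k` is a combination of horizontal words
of length at most `2k`, half of whose letters can be integrated by parts.
-/

noncomputable section

namespace CRSphere

/-! ### Isometric flows on spheres -/

section Flow

variable {E : Type*} [NormedAddCommGroup E] [NormedSpace ℝ E]

theorem hasDerivAt_exp_apply [CompleteSpace E] (A : E →L[ℝ] E) (z : E) (t : ℝ) :
    HasDerivAt (fun s : ℝ => NormedSpace.exp (s • A) z) (A (NormedSpace.exp (t • A) z)) t :=
  (hasDerivAt_exp_smul_const' A t).clm_apply (hasDerivAt_const t z) |>.congr_deriv (by simp)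

theorem exp_zero_smul_apply (A : E →L[ℝ] E) (z : E) : NormedSpace.exp ((0 : ℝ) • A) z = z := by
  rw [zero_smul ℝ A, NormedSpace.exp_zero, one_apply_eq_self]

/-- The homeomorphism of the unit sphere induced by a linear isometry. -/
def sphereHomeomorph (e : E ≃ₗᵢ[ℝ] E) :
    Metric.sphere (0 : E) 1 ≃ₜ Metric.sphere (0 : E) 1 :=
  e.toHomeomorph.subtype fun z => by simp

@[simp]
theorem coe_sphereHomeomorph (e : E ≃ₗᵢ[ℝ] E) (ξ : Metric.sphere (0 : E) 1) :
    (sphereHomeomorph e ξ : E) = e ξ := rfl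

open scoped Pointwise in
theorem Ioo_smul_image_sphereHomeomorph_preimage (e : E ≃ₗᵢ[ℝ] E)
    (s : Set (Metric.sphere (0 : E) 1)) :
    Set.Ioo (0 : ℝ) 1 • (Subtype.val '' (sphereHomeomorph e ⁻¹' s)) =
      e ⁻¹' (Set.Ioo (0 : ℝ) 1 • (Subtype.val '' s)) := by
  ext z
  simp only [Set.mem_smul, Set.mem_image, Set.mem_preimage]
  constructor
  · rintro ⟨r, hr, _, ⟨ξ, hξ, rfl⟩, rfl⟩
    exact ⟨r, hr, _, ⟨_, hξ, rfl⟩, by simp⟩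
  · rintro ⟨r, hr, _, ⟨ξ, hξ, rfl⟩, hz⟩
    refine ⟨r, hr, _, ⟨(sphereHomeomorph e).symm ξ, by simpa using hξ, rfl⟩, e.injective ?_⟩
    rw [map_smul, ← hz, ← coe_sphereHomeomorph, Homeomorph.apply_symm_apply]

theorem measurePreserving_sphereHomeomorph [MeasurableSpace E] [BorelSpace E] {μ : Measure E}
    {e : E ≃ₗᵢ[ℝ] E} (he : MeasurePreserving e μ μ) :
    MeasurePreserving (sphereHomeomorph e) μ.toSphere μ.toSphere := by
  have hmeas := (sphereHomeomorph e).continuous.measurable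
  refine ⟨hmeas, ?_⟩
  ext s hs
  rw [Measure.map_apply hmeas hs, Measure.toSphere_apply' _ hs,
    Measure.toSphere_apply' _ (hmeas hs), Ioo_smul_image_sphereHomeomorph_preimage,
    he.measure_preimage_emb e.toHomeomorph.measurableEmbedding]

end Flow

section SkewFlow

variable {E : Type*} [NormedAddCommGroup E] [InnerProductSpace ℝ E] {A : E →L[ℝ] E}

/-- `A` is skew-symmetric, i.e. the linear vector field `z ↦ A z` is tangent to the spheres centred
at the origin. -/
def IsSkew (A : E →L[ℝ] E) : Prop :=
  ∀ z, inner ℝ z (A z) = 0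

theorem IsSkew.norm_exp_apply [CompleteSpace E] (hA : IsSkew A) (t : ℝ) (z : E) :
    ‖NormedSpace.exp (t • A) z‖ = ‖z‖ := by
  have hderiv : ∀ s : ℝ, HasDerivAt (fun s : ℝ => ‖NormedSpace.exp (s • A) z‖ ^ 2) 0 s :=
    fun s => (hasDerivAt_exp_apply A z s).norm_sq.congr_deriv (by rw [hA, mul_zero])
  have hconst := is_const_of_deriv_eq_zero (fun s => (hderiv s).differentiableAt)
    (fun s => (hderiv s).deriv) t 0
  rw [exp_zero_smul_apply] at hconst
  exact (sq_eq_sq₀ (norm_nonneg _) (norm_nonneg _)).mp hconst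

variable [FiniteDimensional ℝ E]

/-- The time `t` flow of the vector field `z ↦ A z` for a skew-symmetric `A`. -/
def IsSkew.flow (hA : IsSkew A) (t : ℝ) : E ≃ₗᵢ[ℝ] E :=
  LinearIsometry.toLinearIsometryEquiv
    ⟨(NormedSpace.exp (t • A) : E →L[ℝ] E).toLinearMap,
      haveI := FiniteDimensional.complete ℝ E
      hA.norm_exp_apply t⟩ rfl

theorem IsSkew.hasDerivAt_flow_apply (hA : IsSkew A) (z : E) (t : ℝ) :
    HasDerivAt (fun s => hA.flow s z) (A (hA.flow t z)) t :=
  haveI := FiniteDimensional.complete ℝ E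
  hasDerivAt_exp_apply A z t

end SkewFlow

/-! ### Products of square-integrable functions -/

section SquareIntegrable

variable {α 𝕜 : Type*} [RCLike 𝕜] {m : MeasurableSpace α} {μ : Measure α} {f g : α → 𝕜}

theorem eLpNorm_star (f : α → 𝕜) (p : ℝ≥0∞) (μ : Measure α) :
    eLpNorm (star f) p μ = eLpNorm f p μ :=
  eLpNorm_congr_norm_ae (Eventually.of_forall fun x => by simp)

theorem integral_add_mul_of_memLp {f' : α → 𝕜} (hf : MemLp f 2 μ) (hf' : MemLp f' 2 μ)
    (hg : MemLp g 2 μ) :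
    ∫ x, (f + f') x * g x ∂μ = ∫ x, f x * g x ∂μ + ∫ x, f' x * g x ∂μ := by
  simp only [Pi.add_apply, add_mul]
  exact integral_add (hf.integrable_mul hg) (hf'.integrable_mul hg)

theorem norm_integral_mul_le (hf : MemLp f 2 μ) (hg : MemLp g 2 μ) :
    ‖∫ x, f x * g x ∂μ‖ ≤ (eLpNorm f 2 μ).toReal * (eLpNorm g 2 μ).toReal := by
  have hinner : ∫ x, f x * g x ∂μ = inner 𝕜 (hf.star.toLp (star f)) (hg.toLp g) := by
    rw [L2.inner_def]
    refine integral_congr_ae ?_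
    filter_upwards [hf.star.coeFn_toLp, hg.coeFn_toLp] with x hfx hgx
    simp [hfx, hgx, mul_comm]
  rw [hinner, ← eLpNorm_star f, ← Lp.norm_toLp _ hf.star, ← Lp.norm_toLp _ hg]
  exact norm_inner_le_norm _ _

theorem norm_integral_mul_star_self (hf : MemLp f 2 μ) :
    ‖∫ x, f x * star (f x) ∂μ‖ = (eLpNorm f 2 μ).toReal ^ 2 := by
  have hinner : ∫ x, f x * star (f x) ∂μ = inner 𝕜 (hf.toLp f) (hf.toLp f) := by
    rw [L2.inner_def]
    refine integral_congr_ae ?_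
    filter_upwards [hf.coeFn_toLp] with x hfx
    simp [hfx, RCLike.mul_conj]
  rw [hinner, inner_self_eq_norm_sq_to_K, Lp.norm_toLp, norm_pow, RCLike.norm_ofReal,
    abs_of_nonneg ENNReal.toReal_nonneg]

end SquareIntegrable

/-! ### Smooth functions on the sphere -/

variable {n : ℕ} {f g : Sph n → ℂ}

theorem Sph.coe_ne_zero (ξ : Sph n) : (ξ : Amb n) ≠ 0 :=
  ne_zero_of_mem_unit_sphere ξ

theorem exists_eq_norm_smul_coe {z : Amb n} (hz : z ≠ 0) : ∃ ξ : Sph n, z = ‖z‖ • (ξ : Amb n) := by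
  refine ⟨⟨‖z‖⁻¹ • z, ?_⟩, ?_⟩
  · rw [mem_sphere_zero_iff_norm, norm_smul, norm_inv, norm_norm]
    exact inv_mul_cancel₀ (norm_ne_zero_iff.mpr hz)
  · rw [smul_smul, mul_inv_cancel₀ (norm_ne_zero_iff.mpr hz), one_smul]

theorem radialExt_smul_coe (f : Sph n → ℂ) (ξ : Sph n) {r : ℝ} (hr : 0 < r) :
    radialExt f (r • (ξ : Amb n)) = f ξ := by
  have hnorm : ‖r • (ξ : Amb n)‖ = r := by
    rw [norm_smul, norm_eq_of_mem_sphere, mul_one, Real.norm_of_nonneg hr.le]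
  rw [radialExt, dif_neg (smul_ne_zero hr.ne' ξ.coe_ne_zero)]
  refine congrArg f (Subtype.ext ?_)
  change ((‖r • (ξ : Amb n)‖⁻¹ : ℝ) : ℂ) • r • (ξ : Amb n) = ξ
  rw [Complex.coe_smul, hnorm, smul_smul, inv_mul_cancel₀ hr.ne', one_smul]

theorem radialExt_coe (f : Sph n → ℂ) (ξ : Sph n) : radialExt f ξ = f ξ := by
  simpa only [one_smul] using radialExt_smul_coe f ξ one_pos

theorem radialExt_smul (f : Sph n → ℂ) (z : Amb n) {r : ℝ} (hr : 0 < r) :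
    radialExt f (r • z) = radialExt f z := by
  obtain rfl | hz := eq_or_ne z 0
  · rw [smul_zero]
  · obtain ⟨ξ, hξ⟩ := exists_eq_norm_smul_coe hz
    have hpos : 0 < ‖z‖ := norm_pos_iff.mpr hz
    rw [hξ, smul_smul, radialExt_smul_coe f ξ (mul_pos hr hpos), radialExt_smul_coe f ξ hpos]

theorem radialExt_add (f g : Sph n → ℂ) : radialExt (f + g) = radialExt f + radialExt g := by
  ext z
  by_cases hz : z = 0 <;> simp [radialExt, hz]

theorem radialExt_mul (f g : Sph n → ℂ) : radialExt (f * g) = radialExt f * radialExt g := by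
  ext z
  by_cases hz : z = 0 <;> simp [radialExt, hz]

theorem radialExt_const_smul (c : ℂ) (f : Sph n → ℂ) : radialExt (c • f) = c • radialExt f := by
  ext z
  by_cases hz : z = 0 <;> simp [radialExt, hz]

theorem radialExt_star (f : Sph n → ℂ) : radialExt (star f) = fun z => star (radialExt f z) := by
  ext z
  by_cases hz : z = 0 <;> simp [radialExt, hz]

theorem isSmooth_const (c : ℂ) : IsSmooth fun _ : Sph n => c :=
  contDiffOn_const.congr fun z hz => by
    rw [radialExt, dif_neg (Set.mem_compl_singleton_iff.mp hz)]

theorem IsSmooth.add (hf : IsSmooth f) (hg : IsSmooth g) : IsSmooth (f + g) := by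
  rw [IsSmooth, radialExt_add]
  exact ContDiffOn.add hf hg

theorem IsSmooth.mul (hf : IsSmooth f) (hg : IsSmooth g) : IsSmooth (f * g) := by
  rw [IsSmooth, radialExt_mul]
  exact ContDiffOn.mul hf hg

theorem IsSmooth.const_smul (c : ℂ) (hf : IsSmooth f) : IsSmooth (c • f) := by
  rw [IsSmooth, radialExt_const_smul]
  exact ContDiffOn.const_smul c hf

theorem IsSmooth.sub (hf : IsSmooth f) (hg : IsSmooth g) : IsSmooth (f - g) := by
  simpa only [neg_one_smul, sub_eq_add_neg] using hf.add (hg.const_smul (-1))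

theorem IsSmooth.star (hf : IsSmooth f) : IsSmooth (star f) := by
  rw [IsSmooth, radialExt_star]
  exact Complex.conjCLE.contDiff.comp_contDiffOn hf

theorem isSmooth_coord (j : Fin (n + 1)) : IsSmooth (coord j : Sph n → ℂ) := by
  have hnorm : ContDiffOn ℝ ∞ (fun z : Amb n => ‖z‖) {0}ᶜ := fun z hz =>
    (contDiffAt_norm ℝ hz).contDiffWithinAt
  have hproj : ContDiffOn ℝ ∞ (fun z : Amb n => z j) {0}ᶜ :=
    ((EuclideanSpace.proj j : Amb n →L[ℂ] ℂ).restrictScalars ℝ).contDiff.contDiffOn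
  refine ((hnorm.inv fun z hz => norm_ne_zero_iff.mpr hz).smul hproj).congr fun z hz => ?_
  rw [radialExt, dif_neg (Set.mem_compl_singleton_iff.mp hz)]
  simp [coord]

theorem IsSmooth.continuous (hf : IsSmooth f) : Continuous f := by
  rw [show f = fun ξ : Sph n => radialExt f ξ from funext fun ξ => (radialExt_coe f ξ).symm]
  exact (ContDiffOn.continuousOn hf).comp_continuous continuous_subtype_val Sph.coe_ne_zero

theorem IsSmooth.exists_norm_le (hf : IsSmooth f) : ∃ C > 0, ∀ ξ, ‖f ξ‖ ≤ C := by
  simpa only [Set.forall_mem_range] using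
    (isCompact_range hf.continuous).isBounded.exists_pos_norm_le

theorem IsSmooth.contDiffAt (hf : IsSmooth f) {z : Amb n} (hz : z ≠ 0) :
    ContDiffAt ℝ ∞ (radialExt f) z :=
  ContDiffOn.contDiffAt hf (isOpen_compl_singleton.mem_nhds hz)

theorem IsSmooth.differentiableAt (hf : IsSmooth f) (ξ : Sph n) :
    DifferentiableAt ℝ (radialExt f) (ξ : Amb n) :=
  (hf.contDiffAt ξ.coe_ne_zero).differentiableAt (by simp)

instance : IsFiniteMeasure (vol n) :=
  Measure.smul_finite _ (ENNReal.natCast_ne_top _)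

theorem IsSmooth.memLp (hf : IsSmooth f) (p : ℝ≥0∞) : MemLp f p (vol n) :=
  hf.continuous.memLp_of_hasCompactSupport (HasCompactSupport.of_compactSpace f)

theorem IsSmooth.integrable (hf : IsSmooth f) : Integrable f (vol n) :=
  memLp_one_iff_integrable.mp (hf.memLp 1)

theorem IsSmooth.integrable_mul (hf : IsSmooth f) (hg : IsSmooth g) :
    Integrable (fun ξ => f ξ * g ξ) (vol n) :=
  (hf.mul hg).integrable

/-! ### Derivatives along linear vector fields -/

section LinDeriv

variable (A B : Amb n →L[ℝ] Amb n)

/-- The derivative of `f` along the linear vector field `ξ ↦ A ξ`. All the vector fields in this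
development are complex combinations of such derivatives with `A` skew-symmetric. -/
def linDeriv (f : Sph n → ℂ) (ξ : Sph n) : ℂ :=
  dirDeriv f ξ (A ξ)

-- Both sides are positively homogeneous of degree `0`.
theorem radialExt_linDeriv (f : Sph n → ℂ) {z : Amb n} (hz : z ≠ 0) :
    radialExt (linDeriv A f) z = fderiv ℝ (radialExt f) z (A z) := by
  obtain ⟨ξ, hξ⟩ := exists_eq_norm_smul_coe hz
  have hpos : 0 < ‖z‖ := norm_pos_iff.mpr hz
  have hinv : (fun w => radialExt f (‖z‖ • w)) = radialExt f :=
    funext fun w => radialExt_smul f w hpos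
  conv_lhs => rw [hξ, radialExt_smul_coe _ _ hpos, linDeriv, dirDeriv, ← hinv]
  rw [fderiv_comp_smul, ← hξ, smul_apply, ← map_smul, ← map_smul, ← hξ]

theorem IsSmooth.linDeriv (hf : IsSmooth f) : IsSmooth (linDeriv A f) :=
  ((ContDiffOn.fderiv_of_isOpen hf isOpen_compl_singleton (by simp)).clm_apply
    A.contDiff.contDiffOn).congr fun _ hz => radialExt_linDeriv A f hz

theorem linDeriv_add (hf : IsSmooth f) (hg : IsSmooth g) :
    linDeriv A (f + g) = linDeriv A f + linDeriv A g := by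
  ext ξ
  rw [linDeriv, dirDeriv, radialExt_add, fderiv_add (hf.differentiableAt ξ) (hg.differentiableAt ξ)]
  rfl

theorem linDeriv_const_smul (c : ℂ) (hf : IsSmooth f) :
    linDeriv A (c • f) = c • linDeriv A f := by
  ext ξ
  rw [linDeriv, dirDeriv, radialExt_const_smul, fderiv_const_smul (hf.differentiableAt ξ)]
  rfl

theorem linDeriv_mul (hf : IsSmooth f) (hg : IsSmooth g) :
    linDeriv A (f * g) = f * linDeriv A g + linDeriv A f * g := by
  ext ξ
  rw [linDeriv, dirDeriv, radialExt_mul, fderiv_mul (hf.differentiableAt ξ) (hg.differentiableAt ξ)]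
  simp only [add_apply, smul_apply, radialExt_coe, smul_eq_mul, linDeriv, dirDeriv, Pi.add_apply,
    Pi.mul_apply, mul_comm (g ξ)]

theorem linDeriv_star (f : Sph n → ℂ) : linDeriv A (star f) = star (linDeriv A f) := by
  ext ξ
  rw [linDeriv, dirDeriv, radialExt_star, fderiv_star]
  rfl

theorem linDeriv_linDeriv (hf : IsSmooth f) (ξ : Sph n) :
    linDeriv A (linDeriv B f) ξ =
      fderiv ℝ (fderiv ℝ (radialExt f)) ξ (A ξ) (B ξ) + fderiv ℝ (radialExt f) ξ (B (A ξ)) := by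
  have hext : radialExt (linDeriv B f) =ᶠ[𝓝 (ξ : Amb n)]
      fun z => fderiv ℝ (radialExt f) z (B z) := by
    filter_upwards [isOpen_compl_singleton.mem_nhds ξ.coe_ne_zero] with z hz
    exact radialExt_linDeriv B f hz
  have hdiff : DifferentiableAt ℝ (fderiv ℝ (radialExt f)) (ξ : Amb n) :=
    ((hf.contDiffAt ξ.coe_ne_zero).fderiv_right (m := 1) (by norm_cast)).differentiableAt (by simp)
  rw [linDeriv, dirDeriv, hext.fderiv_eq, fderiv_clm_apply hdiff B.differentiableAt]
  simp [add_comm]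

-- The second-order terms of `linDeriv_linDeriv` cancel by symmetry of the second derivative.
theorem linDeriv_comm (hf : IsSmooth f) :
    linDeriv A (linDeriv B f) = linDeriv B (linDeriv A f) + linDeriv (B ∘L A - A ∘L B) f := by
  ext ξ
  have hsymm : IsSymmSndFDerivAt ℝ (radialExt f) (ξ : Amb n) :=
    (hf.contDiffAt ξ.coe_ne_zero).isSymmSndFDerivAt (by
      rw [minSmoothness_of_isRCLikeNormedField]
      exact WithTop.coe_le_coe.mpr (le_top : (2 : ℕ∞) ≤ ⊤))
  rw [Pi.add_apply, linDeriv_linDeriv A B hf, linDeriv_linDeriv B A hf, hsymm.eq]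
  simp [linDeriv, dirDeriv]

end LinDeriv

/-! ### Integration by parts -/

theorem integral_comp_sphereHomeomorph (e : Amb n ≃ₗᵢ[ℝ] Amb n) (f : Sph n → ℂ) :
    ∫ ξ, f (sphereHomeomorph e ξ) ∂(vol n) = ∫ ξ, f ξ ∂(vol n) :=
  ((measurePreserving_sphereHomeomorph e.measurePreserving).smul_measure _).integral_comp
    (sphereHomeomorph e).measurableEmbedding f

variable {A : Amb n →L[ℝ] Amb n}

theorem IsSkew.hasDerivAt_comp_flow (hA : IsSkew A) (hf : IsSmooth f) (ξ : Sph n) (t : ℝ) :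
    HasDerivAt (fun s => f (sphereHomeomorph (hA.flow s) ξ))
      (linDeriv A f (sphereHomeomorph (hA.flow t) ξ)) t := by
  simp only [← radialExt_coe f]
  exact (hf.differentiableAt (sphereHomeomorph (hA.flow t) ξ)).hasFDerivAt.comp_hasDerivAt t
    (hA.hasDerivAt_flow_apply ξ t)

-- `∫ f ∘ flow t` does not depend on `t`; differentiate at `t = 0`.
theorem IsSkew.integral_linDeriv (hA : IsSkew A) (hf : IsSmooth f) :
    ∫ ξ, linDeriv A f ξ ∂(vol n) = 0 := by
  obtain ⟨C, -, hC⟩ := (hf.linDeriv A).exists_norm_le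
  have hcont : ∀ t, Continuous fun ξ => f (sphereHomeomorph (hA.flow t) ξ) := fun t =>
    hf.continuous.comp (sphereHomeomorph _).continuous
  have hderiv := (hasDerivAt_integral_of_dominated_loc_of_deriv_le (μ := vol n) (𝕜 := ℝ)
    (F := fun t ξ => f (sphereHomeomorph (hA.flow t) ξ))
    (F' := fun t ξ => linDeriv A f (sphereHomeomorph (hA.flow t) ξ)) (bound := fun _ => C)
    (x₀ := 0) univ_mem (Eventually.of_forall fun t => (hcont t).aestronglyMeasurable)
    ((hcont 0).integrable_of_hasCompactSupport (HasCompactSupport.of_compactSpace _))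
    ((hf.linDeriv A).continuous.comp (sphereHomeomorph _).continuous).aestronglyMeasurable
    (Eventually.of_forall fun ξ t _ => hC _) (integrable_const C)
    (Eventually.of_forall fun ξ t _ => hA.hasDerivAt_comp_flow hf ξ t)).2
  simp only [integral_comp_sphereHomeomorph] at hderiv
  exact hderiv.unique (hasDerivAt_const 0 _)

theorem IsSkew.integral_mul_linDeriv (hA : IsSkew A) (hf : IsSmooth f) (hg : IsSmooth g) :
    ∫ ξ, f ξ * linDeriv A g ξ ∂(vol n) = -∫ ξ, linDeriv A f ξ * g ξ ∂(vol n) := by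
  rw [eq_neg_iff_add_eq_zero, ← integral_add (hf.integrable_mul (hg.linDeriv A))
    ((hf.linDeriv A).integrable_mul hg), ← hA.integral_linDeriv (hf.mul hg), linDeriv_mul A hf hg]
  rfl

/-! ### Operators on smooth functions -/

/-- The space `C^∞(S^{2n+1}; ℂ)`. Differential operators are elements of the ring
`Module.End ℂ (smoothFun n)`, so that identities between them need no smoothness hypotheses. -/
def smoothFun (n : ℕ) : Submodule ℂ (Sph n → ℂ) where
  carrier := {f | IsSmooth f}
  add_mem' := IsSmooth.add
  zero_mem' := isSmooth_const 0
  smul_mem' := fun c _ => IsSmooth.const_smul c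

theorem coe_prod_map_apply {ι : Type*} {O : ι → Module.End ℂ (smoothFun n)}
    {o : ι → (Sph n → ℂ) → Sph n → ℂ} (h : ∀ i (f : smoothFun n), (O i f : Sph n → ℂ) = o i f)
    (l : List ι) (f : smoothFun n) : ((l.map O).prod f : Sph n → ℂ) = l.foldr o f := by
  induction l with
  | nil => rfl
  | cons i l ih => rw [List.map_cons, List.prod_cons, Module.End.mul_apply, h, ih, List.foldr_cons]

theorem foldr_star {ι : Type*} {o : ι → (Sph n → ℂ) → Sph n → ℂ} {σ : ι → ι}
    (h : ∀ i f, o i (star f) = star (o (σ i) f)) (l : List ι) (f : Sph n → ℂ) :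
    l.foldr o (star f) = star ((l.map σ).foldr o f) := by
  induction l with
  | nil => rfl
  | cons i l ih => rw [List.foldr_cons, ih, h, List.map_cons, List.foldr_cons]

/-- `linDeriv A` as an operator on smooth functions. -/
def smoothDeriv (A : Amb n →L[ℝ] Amb n) : Module.End ℂ (smoothFun n) where
  toFun f := ⟨linDeriv A f, f.2.linDeriv A⟩
  map_add' f g := Subtype.ext (linDeriv_add A f.2 g.2)
  map_smul' c f := Subtype.ext (linDeriv_const_smul A c f.2)

theorem coe_smoothDeriv_apply (A : Amb n →L[ℝ] Amb n) (f : smoothFun n) :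
    (smoothDeriv A f : Sph n → ℂ) = linDeriv A f :=
  rfl

theorem smoothDeriv_smul (c : ℝ) (A : Amb n →L[ℝ] Amb n) :
    smoothDeriv (c • A) = (c : ℂ) • smoothDeriv A := by
  ext f ξ
  exact map_smul (fderiv ℝ (radialExt f) ξ) c (A ξ)

theorem smoothDeriv_sum {ι : Type*} (s : Finset ι) (A : ι → Amb n →L[ℝ] Amb n) :
    smoothDeriv (∑ i ∈ s, A i) = ∑ i ∈ s, smoothDeriv (A i) := by
  ext f ξ
  simp only [coe_smoothDeriv_apply, linDeriv, dirDeriv, sum_apply, map_sum, LinearMap.sum_apply,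
    AddSubmonoidClass.coe_finsetSum, Finset.sum_apply]

theorem lie_smoothDeriv (A B : Amb n →L[ℝ] Amb n) :
    ⁅smoothDeriv A, smoothDeriv B⁆ = smoothDeriv ⁅B, A⁆ := by
  ext f : 2
  rw [Ring.lie_def, Ring.lie_def]
  exact sub_eq_of_eq_add' (linDeriv_comm A B f.2)

/-- The bilinear form `(f, g) ↦ ∫ f g dξ`, without complex conjugation. -/
def integralForm (n : ℕ) : LinearMap.BilinForm ℂ (smoothFun n) :=
  LinearMap.mk₂ ℂ (fun f g => ∫ ξ, (f : Sph n → ℂ) ξ * (g : Sph n → ℂ) ξ ∂(vol n))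
    (fun f f' g => by
      rw [← integral_add (f.2.integrable_mul g.2) (f'.2.integrable_mul g.2)]
      simp only [← add_mul]
      rfl)
    (fun c f g => by
      rw [smul_eq_mul, ← integral_const_mul]
      exact integral_congr_ae (.of_forall fun ξ => mul_assoc c _ _))
    (fun f g g' => by
      rw [← integral_add (f.2.integrable_mul g.2) (f.2.integrable_mul g'.2)]
      simp only [← mul_add]
      rfl)
    (fun c f g => by
      rw [smul_eq_mul, ← integral_const_mul]
      exact integral_congr_ae (.of_forall fun ξ => mul_left_comm _ c _))

theorem integralForm_apply (f g : smoothFun n) :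
    integralForm n f g = ∫ ξ, (f : Sph n → ℂ) ξ * (g : Sph n → ℂ) ξ ∂(vol n) :=
  rfl

/-- `O'` is the transpose of `O` for the bilinear form `∫ f g dξ`. -/
abbrev IsTranspose (O' O : Module.End ℂ (smoothFun n)) : Prop :=
  LinearMap.IsAdjointPair (integralForm n) (integralForm n) O' O

section Transpose

variable {ι : Type*} {O₁ O₁' O₂ O₂' : Module.End ℂ (smoothFun n)}
  {O O' : ι → Module.End ℂ (smoothFun n)}

theorem IsTranspose.add (h₁ : IsTranspose O₁' O₁) (h₂ : IsTranspose O₂' O₂) :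
    IsTranspose (O₁' + O₂') (O₁ + O₂) :=
  LinearMap.IsAdjointPair.add h₁ h₂

theorem IsTranspose.smul (h : IsTranspose O₁' O₁) (c : ℂ) : IsTranspose (c • O₁') (c • O₁) :=
  LinearMap.IsAdjointPair.smul c h

theorem IsTranspose.mul (h₁ : IsTranspose O₁' O₁) (h₂ : IsTranspose O₂' O₂) :
    IsTranspose (O₂' * O₁') (O₁ * O₂) :=
  LinearMap.IsAdjointPair.mul h₂ h₁

theorem IsTranspose.sum {s : Finset ι} (h : ∀ i ∈ s, IsTranspose (O' i) (O i)) :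
    IsTranspose (∑ i ∈ s, O' i) (∑ i ∈ s, O i) := fun f g => by
  simp only [LinearMap.sum_apply, map_sum]
  exact Finset.sum_congr rfl fun i hi => h i hi f g

theorem IsTranspose.prod_map (h : ∀ i, IsTranspose (O' i) (O i)) (l : List ι) :
    IsTranspose (l.reverse.map O').prod (l.map O).prod := by
  induction l with
  | nil => exact LinearMap.isAdjointPair_one
  | cons i l ih =>
    rw [List.reverse_cons, List.map_append, List.prod_append, List.map_singleton,
      List.prod_singleton, List.map_cons, List.prod_cons]
    exact (h i).mul ih

end Transpose

theorem IsSkew.isTranspose_smoothDeriv (hA : IsSkew A) :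
    IsTranspose (-smoothDeriv A) (smoothDeriv A) := fun f g => by
  rw [LinearMap.neg_apply, map_neg, LinearMap.neg_apply, integralForm_apply, integralForm_apply]
  exact (hA.integral_mul_linDeriv f.2 g.2).symm

/-! ### The horizontal fields and the Reeb field -/

section Commutators

variable {R : Type*} [Ring R]

theorem lie_smul_add_smul [Algebra ℂ R] (c d : ℂ) (x y z : R) :
    ⁅x, c • (y + d • z)⁆ = c • (⁅x, y⁆ + d • ⁅x, z⁆) := by
  simp only [Ring.lie_def, mul_smul_comm, smul_mul_assoc, mul_add, add_mul]
  module

theorem lie_half_smul_sub_add [Algebra ℂ R] (x y : R) :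
    ⁅(1 / 2 : ℂ) • (x + (-Complex.I) • y), (1 / 2 : ℂ) • (x + Complex.I • y)⁆ =
      (Complex.I / 2) • ⁅x, y⁆ := by
  simp only [Ring.lie_def, mul_smul_comm, smul_mul_assoc, mul_add, add_mul]
  module

variable [Module ℝ R] {H J : R}

theorem lie_of_mul_eq_neg_mul (hHJ : H * J = -(J * H)) : ⁅H, J⁆ = (-2 : ℝ) • (J * H) := by
  rw [Ring.lie_def, hHJ]
  module

theorem lie_mul_left_of_mul_eq_neg_mul (hHJ : H * J = -(J * H)) (hJ : J * J = -1) :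
    ⁅J * H, J⁆ = (2 : ℝ) • H := by
  rw [Ring.lie_def, mul_assoc, hHJ, mul_neg, ← mul_assoc, hJ, neg_one_mul]
  module

theorem lie_mul_self_of_mul_eq_neg_mul (hHJ : H * J = -(J * H)) :
    ⁅J * H, H⁆ = (2 : ℝ) • (J * (H * H)) := by
  rw [Ring.lie_def, ← mul_assoc H, hHJ, neg_mul, mul_assoc]
  module

end Commutators

/-- Multiplication by `i`, the linear vector field generating the Reeb flow. -/
def mulI : Amb n →L[ℝ] Amb n :=
  (Complex.I • ContinuousLinearMap.id ℂ (Amb n)).restrictScalars ℝ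

/-- The real-linear map `z ↦ z̄_j e_l - z̄_l e_j`, whose restriction to the sphere is
`horizVec j l`. -/
def horizMap (j l : Fin (n + 1)) : Amb n →L[ℝ] Amb n :=
  LinearMap.toContinuousLinearMap
    { toFun := fun z => EuclideanSpace.single l (star (z j)) - EuclideanSpace.single j (star (z l))
      map_add' := fun z w => by
        ext m
        simp only [PiLp.add_apply, PiLp.sub_apply, PiLp.single_apply, star_add]
        split_ifs <;> ring
      map_smul' := fun c z => by
        ext m
        simp [mul_sub] }

theorem mulI_apply (z : Amb n) : mulI z = Complex.I • z :=
  rfl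

theorem horizMap_apply (j l : Fin (n + 1)) (z : Amb n) :
    horizMap j l z =
      EuclideanSpace.single l (star (z j)) - EuclideanSpace.single j (star (z l)) :=
  rfl

theorem mulI_mul_mulI : (mulI * mulI : Amb n →L[ℝ] Amb n) = -1 := by
  ext1 z
  change Complex.I • Complex.I • z = -z
  rw [smul_smul, Complex.I_mul_I, neg_one_smul]

theorem horizMap_mul_mulI (j l : Fin (n + 1)) : horizMap j l * mulI = -(mulI * horizMap j l) := by
  ext z m
  simp only [mul_apply_eq_comp, neg_apply, mulI_apply, horizMap_apply, PiLp.smul_apply,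
    PiLp.sub_apply, PiLp.neg_apply, PiLp.single_apply, smul_eq_mul, star_mul', RCLike.star_def,
    Complex.conj_I]
  split_ifs <;> ring

theorem sum_mul_horizMap_horizMap :
    ∑ j, ∑ l, horizMap j l * horizMap j l = (-2 * n : ℝ) • (1 : Amb n →L[ℝ] Amb n) := by
  ext z m
  simp [horizMap_apply, Pi.single_apply, Finset.sum_sub_distrib, apply_ite (starRingEnd ℂ),
    Finset.sum_ite_irrel]
  ring

theorem isSkew_mulI : IsSkew (mulI : Amb n →L[ℝ] Amb n) := fun z => by
  simp only [PiLp.inner_apply, mulI_apply, PiLp.smul_apply, Complex.inner]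
  refine Finset.sum_eq_zero fun m _ => ?_
  simp only [smul_eq_mul, Complex.mul_re, Complex.mul_im, Complex.I_re, Complex.I_im,
    Complex.conj_re, Complex.conj_im]
  ring

theorem isSkew_horizMap (j l : Fin (n + 1)) : IsSkew (horizMap j l) := fun z => by
  simp only [horizMap_apply, RCLike.star_def, inner_sub_right, PiLp.inner_apply, PiLp.single_apply,
    apply_ite (inner ℝ _), inner_zero_right, Finset.sum_ite_eq', Finset.mem_univ, if_true,
    Complex.inner, Complex.mul_re, Complex.conj_re, Complex.conj_im]
  ring

theorem isSkew_mulI_mul_horizMap (j l : Fin (n + 1)) : IsSkew (mulI * horizMap j l) := fun z => by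
  simp only [mul_apply_eq_comp, horizMap_apply, mulI_apply, RCLike.star_def, PiLp.inner_apply,
    PiLp.smul_apply, PiLp.sub_apply, PiLp.single_apply, smul_eq_mul, mul_sub, mul_ite, mul_zero,
    inner_sub_right, apply_ite (inner ℝ _), inner_zero_right, Finset.sum_sub_distrib,
    Finset.sum_ite_eq', Finset.mem_univ, if_true, Complex.inner, Complex.mul_re, Complex.mul_im,
    Complex.I_re, Complex.I_im, Complex.conj_re, Complex.conj_im]
  ring

/-- The unit `-i` or `i` distinguishing `Z_{jl}` from `Z̄_{jl}`. -/
def labelUnit (b : Bool) : ℂ :=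
  if b then Complex.I else -Complex.I

theorem labelUnit_mul_self (b : Bool) : labelUnit b * labelUnit b = -1 := by
  cases b <;> simp [labelUnit]

theorem labelUnit_not (b : Bool) : labelUnit (!b) = -labelUnit b := by
  cases b <;> simp [labelUnit]

theorem star_labelUnit (b : Bool) : star (labelUnit b) = labelUnit (!b) := by
  cases b <;> simp [labelUnit]

theorem horiz_eq (a : Label n) (f : Sph n → ℂ) :
    horiz a f = (1 / 2 : ℂ) • (linDeriv (horizMap a.1 a.2.1) f +
      labelUnit a.2.2 • linDeriv (mulI * horizMap a.1 a.2.1) f) := by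
  have hvec : ∀ (j l) (ξ : Sph n), horizMap j l ξ = horizVec j l ξ := fun _ _ _ => rfl
  obtain ⟨j, l, _ | _⟩ := a <;> ext ξ <;>
    simp [horiz, Z, Zbar, linDeriv, labelUnit, mulI_apply, hvec] <;> ring

theorem IsSmooth.horiz (hf : IsSmooth f) (a : Label n) : IsSmooth (horiz a f) := by
  rw [horiz_eq]
  exact ((hf.linDeriv _).add ((hf.linDeriv _).const_smul _)).const_smul _

theorem horiz_mul (a : Label n) (hf : IsSmooth f) (hg : IsSmooth g) :
    horiz a (f * g) = f * horiz a g + horiz a f * g := by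
  simp only [horiz_eq, linDeriv_mul _ hf hg]
  ext ξ
  simp only [Pi.smul_apply, Pi.add_apply, Pi.mul_apply, smul_eq_mul]
  ring

/-- The label of the complex conjugate field. -/
def Label.conj (a : Label n) : Label n :=
  (a.1, a.2.1, !a.2.2)

theorem Label.conj_conj (a : Label n) : a.conj.conj = a := by
  simp [Label.conj]

theorem horiz_star (a : Label n) (f : Sph n → ℂ) : horiz a (star f) = star (horiz a.conj f) := by
  simp only [Label.conj, horiz_eq, linDeriv_star, star_smul, star_add, star_labelUnit]
  simp

/-- `horiz a` as an operator on smooth functions. -/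
def horizEnd (a : Label n) : Module.End ℂ (smoothFun n) :=
  (1 / 2 : ℂ) • (smoothDeriv (n := n) (horizMap a.1 a.2.1) +
    labelUnit a.2.2 • smoothDeriv (n := n) (mulI * horizMap a.1 a.2.1))

/-- The Reeb field as an operator on smooth functions. -/
def reebEnd (n : ℕ) : Module.End ℂ (smoothFun n) :=
  smoothDeriv mulI

theorem coe_horizEnd_apply (a : Label n) (f : smoothFun n) :
    (horizEnd a f : Sph n → ℂ) = horiz a f :=
  (horiz_eq a f).symm

theorem coe_reebEnd_apply (f : smoothFun n) : (reebEnd n f : Sph n → ℂ) = reeb f :=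
  rfl

theorem isTranspose_horizEnd (a : Label n) : IsTranspose (-horizEnd a) (horizEnd a) := by
  have h := ((isSkew_horizMap a.1 a.2.1).isTranspose_smoothDeriv.add
    ((isSkew_mulI_mul_horizMap a.1 a.2.1).isTranspose_smoothDeriv.smul
      (labelUnit a.2.2))).smul (1 / 2 : ℂ)
  convert h using 1
  · rw [horizEnd]
    module
  · rfl

theorem isTranspose_reebEnd (n : ℕ) : IsTranspose (-reebEnd n) (reebEnd n) :=
  isSkew_mulI.isTranspose_smoothDeriv

theorem lie_reebEnd_horizEnd (a : Label n) :
    ⁅reebEnd n, horizEnd a⁆ = (2 * labelUnit a.2.2) • horizEnd a := by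
  have hHJ := horizMap_mul_mulI a.1 a.2.1
  rw [reebEnd, horizEnd, lie_smul_add_smul (R := Module.End ℂ (smoothFun n)), lie_smoothDeriv,
    lie_smoothDeriv, lie_of_mul_eq_neg_mul hHJ, lie_mul_left_of_mul_eq_neg_mul hHJ mulI_mul_mulI,
    smoothDeriv_smul, smoothDeriv_smul]
  match_scalars
  · linear_combination -labelUnit_mul_self a.2.2
  · ring

theorem lie_horizEnd_false_true (j l : Fin (n + 1)) :
    ⁅horizEnd (j, l, false), horizEnd (j, l, true)⁆ =
      Complex.I • smoothDeriv (n := n) (mulI * (horizMap j l * horizMap j l)) := by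
  change ⁅(1 / 2 : ℂ) • (_ + (-Complex.I) • _), (1 / 2 : ℂ) • (_ + Complex.I • _)⁆ = _
  rw [lie_half_smul_sub_add (R := Module.End ℂ (smoothFun n)), lie_smoothDeriv,
    lie_mul_self_of_mul_eq_neg_mul (horizMap_mul_mulI j l), smoothDeriv_smul]
  push_cast
  module

theorem sum_lie_horizEnd_false_true :
    ∑ j, ∑ l, ⁅horizEnd (j, l, false), horizEnd (j, l, true)⁆ =
      (-2 * n * Complex.I : ℂ) • reebEnd n := by
  have hmul : (mulI * (-2 * n : ℝ) • 1 : Amb n →L[ℝ] Amb n) = (-2 * n : ℝ) • mulI := by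
    ext1 z
    exact map_smul mulI _ z
  simp only [lie_horizEnd_false_true, ← Finset.smul_sum, ← smoothDeriv_sum, ← Finset.mul_sum,
    sum_mul_horizMap_horizMap, hmul, smoothDeriv_smul, reebEnd]
  push_cast
  module

/-! ### The CR GJMS operators -/

theorem commute_mul_of_lie_eq_smul {R : Type*} [Ring R] [Algebra ℂ R] {c : ℂ} {T X Y : R}
    (hX : ⁅T, X⁆ = c • X) (hY : ⁅T, Y⁆ = (-c) • Y) : Commute T (X * Y) := by
  rw [Ring.lie_def, sub_eq_iff_eq_add] at hX hY
  rw [Commute, SemiconjBy, ← mul_assoc, hX, add_mul, mul_assoc X, hY, mul_add, smul_mul_assoc,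
    mul_smul_comm, neg_smul, mul_assoc, add_neg_cancel_left]

/-- The sub-Laplacian as an operator on smooth functions. -/
def subLaplacianEnd (n : ℕ) : Module.End ℂ (smoothFun n) :=
  (-(1 / 2) : ℂ) • ∑ j, ∑ l, (horizEnd (j, l, false) * horizEnd (j, l, true) +
    horizEnd (j, l, true) * horizEnd (j, l, false))

/-- `Lop μ` as an operator on smooth functions. -/
def LopEnd (n : ℕ) (μ : ℝ) : Module.End ℂ (smoothFun n) :=
  (1 / 2 : ℂ) • subLaplacianEnd n + (Complex.I / 2 * μ) • reebEnd n +
    (1 / 4 * ((n : ℂ) - μ) * ((n : ℂ) + μ)) • 1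

theorem coe_subLaplacianEnd_apply (f : smoothFun n) :
    (subLaplacianEnd n f : Sph n → ℂ) = subLaplacian f := by
  ext ξ
  simp only [subLaplacianEnd, LinearMap.smul_apply, LinearMap.sum_apply, LinearMap.add_apply,
    Module.End.mul_apply, Submodule.coe_smul, Submodule.coe_add, AddSubmonoidClass.coe_finsetSum,
    Finset.sum_apply, Pi.smul_apply, Pi.add_apply, coe_horizEnd_apply, smul_eq_mul, subLaplacian]
  rfl

theorem coe_LopEnd_apply (μ : ℝ) (f : smoothFun n) :
    (LopEnd n μ f : Sph n → ℂ) = Lop μ f := by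
  ext ξ
  simp only [LopEnd, LinearMap.smul_apply, LinearMap.add_apply, Module.End.one_apply,
    Submodule.coe_smul, Submodule.coe_add, Pi.smul_apply, Pi.add_apply,
    coe_subLaplacianEnd_apply, coe_reebEnd_apply, smul_eq_mul, Lop]

theorem commute_reebEnd_horizEnd_mul (j l : Fin (n + 1)) (b : Bool) :
    Commute (reebEnd n) (horizEnd (j, l, b) * horizEnd (j, l, !b)) := by
  refine commute_mul_of_lie_eq_smul (lie_reebEnd_horizEnd _) ?_
  rw [lie_reebEnd_horizEnd, labelUnit_not, mul_neg]

theorem commute_reebEnd_subLaplacianEnd : Commute (reebEnd n) (subLaplacianEnd n) :=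
  .smul_right (.sum_right _ _ _ fun j _ => .sum_right _ _ _ fun l _ =>
    (commute_reebEnd_horizEnd_mul j l false).add_right (commute_reebEnd_horizEnd_mul j l true)) _

theorem commute_LopEnd (μ ν : ℝ) : Commute (LopEnd n μ) (LopEnd n ν) := by
  have h := commute_reebEnd_subLaplacianEnd (n := n)
  refine .add_left (.add_left (.smul_left ?_ _) (.smul_left ?_ _))
    (.smul_left (.one_left _) _)
  · exact (((Commute.refl _).smul_right _).add_right (h.symm.smul_right _)).add_right
      ((Commute.one_right _).smul_right _)
  · exact ((h.smul_right _).add_right ((Commute.refl _).smul_right _)).add_right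
      ((Commute.one_right _).smul_right _)

theorem isTranspose_horizEnd_mul (a b : Label n) :
    IsTranspose (horizEnd b * horizEnd a) (horizEnd a * horizEnd b) := fun f g => by
  simpa only [Module.End.mul_apply, LinearMap.neg_apply, map_neg, neg_neg] using
    (isTranspose_horizEnd a).mul (isTranspose_horizEnd b) f g

theorem isTranspose_subLaplacianEnd (n : ℕ) :
    IsTranspose (subLaplacianEnd n) (subLaplacianEnd n) := by
  refine IsTranspose.smul (.sum fun j _ => .sum fun l _ => ?_) _
  have h := (isTranspose_horizEnd_mul (n := n) (j, l, false) (j, l, true)).add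
    (isTranspose_horizEnd_mul (j, l, true) (j, l, false))
  convert h using 1
  exact add_comm _ _

theorem isTranspose_LopEnd (μ : ℝ) : IsTranspose (LopEnd n (-μ)) (LopEnd n μ) := by
  have h := (((isTranspose_subLaplacianEnd n).smul (1 / 2)).add
    ((isTranspose_reebEnd n).smul (Complex.I / 2 * μ))).add
      (IsTranspose.smul LinearMap.isAdjointPair_one (1 / 4 * ((n : ℂ) - μ) * ((n : ℂ) + μ)))
  convert h using 1
  · rw [LopEnd]
    push_cast
    module
  · rfl

/-- The parameters `k - 1, k - 3, …, 1 - k` of the factors of `P_k`. -/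
def gjmsParams (k : ℕ) : List ℝ :=
  (List.range k).map fun j : ℕ => (k : ℝ) - 2 * j - 1

theorem reverse_gjmsParams (k : ℕ) : (gjmsParams k).reverse = (gjmsParams k).map (-·) := by
  refine List.ext_getElem (by simp [gjmsParams]) fun i hi _ => ?_
  have hik : i < k := by simpa [gjmsParams] using hi
  simp only [gjmsParams, List.getElem_reverse, List.getElem_map, List.getElem_range,
    List.length_map, List.length_range]
  rw [Nat.cast_sub (by omega), Nat.cast_sub (by omega)]
  push_cast
  ring

theorem gjms_eq_foldr (k : ℕ) (f : Sph n → ℂ) : gjms k f = (gjmsParams k).foldr Lop f := by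
  -- `gjms` coerces `List.range k` to a list of real numbers by a monadic bind.
  have hcast : (do let j ← List.range k; pure (j : ℝ)) = (List.range k).map (Nat.cast : ℕ → ℝ) :=
    List.flatMap_pure_eq_map _ _
  rw [gjms, hcast, gjmsParams, List.foldr_map, List.foldr_map]

/-- The CR GJMS operator `gjms k` as an operator on smooth functions. -/
def gjmsEnd (n k : ℕ) : Module.End ℂ (smoothFun n) :=
  ((gjmsParams k).map (LopEnd n)).prod

theorem coe_gjmsEnd_apply (k : ℕ) (f : smoothFun n) : (gjmsEnd n k f : Sph n → ℂ) = gjms k f := by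
  rw [gjms_eq_foldr]
  exact coe_prod_map_apply coe_LopEnd_apply _ f

theorem IsSmooth.gjms (hf : IsSmooth f) (k : ℕ) : IsSmooth (gjms k f) :=
  coe_gjmsEnd_apply k ⟨f, hf⟩ ▸ (gjmsEnd n k ⟨f, hf⟩).2

theorem isTranspose_gjmsEnd (n k : ℕ) : IsTranspose (gjmsEnd n k) (gjmsEnd n k) := by
  have h := IsTranspose.prod_map (isTranspose_LopEnd (n := n)) (gjmsParams k)
  simpa only [reverse_gjmsParams, List.map_map, Function.comp_def, neg_neg, gjmsEnd] using h

theorem prod_map_LopEnd_neg (n k : ℕ) :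
    (((gjmsParams k).map (-·)).map (LopEnd n)).prod = gjmsEnd n k := by
  rw [← reverse_gjmsParams]
  refine ((gjmsParams k).reverse_perm.map _).prod_eq' ?_
  exact List.pairwise_map.mpr (List.pairwise_of_forall commute_LopEnd)

theorem subLaplacian_star (f : Sph n → ℂ) : subLaplacian (star f) = star (subLaplacian f) := by
  have hZ (j l : Fin (n + 1)) (f : Sph n → ℂ) : Z j l (star f) = star (Zbar j l f) :=
    horiz_star (j, l, false) f
  have hZbar (j l : Fin (n + 1)) (f : Sph n → ℂ) : Zbar j l (star f) = star (Z j l f) :=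
    horiz_star (j, l, true) f
  ext ξ
  simp [subLaplacian, hZ, hZbar, add_comm]

theorem Lop_star (μ : ℝ) (f : Sph n → ℂ) : Lop μ (star f) = star (Lop (-μ) f) := by
  have hreeb : reeb (star f) = star (reeb f) := linDeriv_star mulI f
  ext ξ
  simp only [Lop, subLaplacian_star, hreeb, Pi.star_apply, RCLike.star_def, map_add, map_sub,
    map_neg, map_mul, map_div₀, map_one, map_ofNat, map_natCast, Complex.conj_I,
    Complex.conj_ofReal, Complex.ofReal_neg]
  ring

theorem gjms_star (k : ℕ) (hf : IsSmooth f) : gjms k (star f) = star (gjms k f) := by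
  rw [gjms_eq_foldr, foldr_star Lop_star, ← coe_prod_map_apply coe_LopEnd_apply _ ⟨f, hf⟩,
    prod_map_LopEnd_neg, coe_gjmsEnd_apply]

/-! ### Operators of finite horizontal order -/

/-- `horizWord w` as an operator on smooth functions. -/
def wordEnd (w : List (Label n)) : Module.End ℂ (smoothFun n) :=
  (w.map horizEnd).prod

theorem coe_wordEnd_apply (w : List (Label n)) (f : smoothFun n) :
    (wordEnd w f : Sph n → ℂ) = horizWord w f :=
  coe_prod_map_apply coe_horizEnd_apply w f

theorem wordEnd_append (v w : List (Label n)) : wordEnd (v ++ w) = wordEnd v * wordEnd w := by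
  rw [wordEnd, List.map_append, List.prod_append, wordEnd, wordEnd]

theorem integralForm_wordEnd (w : List (Label n)) (f g : smoothFun n) :
    integralForm n f (wordEnd w g) =
      (-1) ^ w.length * integralForm n (wordEnd w.reverse f) g := by
  induction w generalizing f with
  | nil => simp [wordEnd]
  | cons a w ih =>
    calc integralForm n f (wordEnd (a :: w) g)
        = integralForm n f (horizEnd a (wordEnd w g)) := rfl
      _ = -integralForm n (horizEnd a f) (wordEnd w g) := by
        rw [← isTranspose_horizEnd a f, LinearMap.neg_apply, map_neg, LinearMap.neg_apply]
      _ = (-1) ^ (a :: w).length * integralForm n (wordEnd (a :: w).reverse f) g := by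
        rw [ih, List.reverse_cons, wordEnd_append, List.length_cons, pow_succ,
          Module.End.mul_apply]
        simp [wordEnd]

/-- The operators of horizontal order at most `m`: the linear combinations of words of length at
most `m` in the horizontal fields. -/
def horizOrder (n m : ℕ) : Submodule ℂ (Module.End ℂ (smoothFun n)) :=
  Submodule.span ℂ (wordEnd '' {w | w.length ≤ m})

theorem wordEnd_mem_horizOrder {m : ℕ} {w : List (Label n)} (hw : w.length ≤ m) :
    wordEnd w ∈ horizOrder n m :=
  Submodule.subset_span (Set.mem_image_of_mem _ hw)

theorem mul_mem_horizOrder {l m : ℕ} {O₁ O₂ : Module.End ℂ (smoothFun n)}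
    (h₁ : O₁ ∈ horizOrder n l) (h₂ : O₂ ∈ horizOrder n m) : O₁ * O₂ ∈ horizOrder n (l + m) := by
  have h : horizOrder n l * horizOrder n m ≤ horizOrder n (l + m) := by
    rw [horizOrder, horizOrder, Submodule.span_mul_span, Submodule.span_le]
    rintro _ ⟨_, ⟨v, hv, rfl⟩, _, ⟨w, hw, rfl⟩, rfl⟩
    change wordEnd v * wordEnd w ∈ horizOrder n (l + m)
    rw [← wordEnd_append]
    exact wordEnd_mem_horizOrder (List.length_append ▸ add_le_add hv hw)
  exact h (Submodule.mul_mem_mul h₁ h₂)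

theorem one_mem_horizOrder (n m : ℕ) : 1 ∈ horizOrder n m :=
  wordEnd_mem_horizOrder (w := []) m.zero_le

theorem horizEnd_mul_mem_horizOrder (a b : Label n) : horizEnd a * horizEnd b ∈ horizOrder n 2 := by
  simpa [wordEnd] using wordEnd_mem_horizOrder (w := [a, b]) le_rfl

theorem lie_horizEnd_mem_horizOrder (a b : Label n) :
    ⁅horizEnd a, horizEnd b⁆ ∈ horizOrder n 2 := by
  have hlie : ⁅horizEnd a, horizEnd b⁆ =
      horizEnd a * horizEnd b + (-1 : ℂ) • (horizEnd b * horizEnd a) := by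
    rw [Ring.lie_def]
    module
  rw [hlie]
  exact add_mem (horizEnd_mul_mem_horizOrder a b)
    (Submodule.smul_mem _ _ (horizEnd_mul_mem_horizOrder b a))

theorem subLaplacianEnd_mem_horizOrder (n : ℕ) : subLaplacianEnd n ∈ horizOrder n 2 :=
  Submodule.smul_mem _ _ (sum_mem fun _ _ => sum_mem fun _ _ =>
    add_mem (horizEnd_mul_mem_horizOrder _ _) (horizEnd_mul_mem_horizOrder _ _))

theorem reebEnd_mem_horizOrder (hn : n ≠ 0) : reebEnd n ∈ horizOrder n 2 := by
  have hc : (-2 * n * Complex.I : ℂ) ≠ 0 := by simp [hn]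
  rw [← Submodule.smul_mem_iff _ hc, ← sum_lie_horizEnd_false_true]
  exact sum_mem fun _ _ => sum_mem fun _ _ => lie_horizEnd_mem_horizOrder _ _

theorem LopEnd_mem_horizOrder (hn : n ≠ 0) (μ : ℝ) : LopEnd n μ ∈ horizOrder n 2 :=
  add_mem (add_mem (Submodule.smul_mem _ _ (subLaplacianEnd_mem_horizOrder n))
    (Submodule.smul_mem _ _ (reebEnd_mem_horizOrder hn)))
    (Submodule.smul_mem _ _ (one_mem_horizOrder n 2))

theorem gjmsEnd_mem_horizOrder (hn : n ≠ 0) (k : ℕ) : gjmsEnd n k ∈ horizOrder n (2 * k) := by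
  have hprod (l : List ℝ) : (l.map (LopEnd n)).prod ∈ horizOrder n (2 * l.length) := by
    induction l with
    | nil => exact one_mem_horizOrder n _
    | cons μ l ih =>
      rw [List.map_cons, List.prod_cons, List.length_cons, mul_add_one, add_comm]
      exact mul_mem_horizOrder (LopEnd_mem_horizOrder hn μ) ih
  simpa [gjmsEnd, gjmsParams] using hprod (gjmsParams k)

/-! ### The Folland–Stein norm -/

section FollandStein

variable {k : ℕ} {w v : List (Label n)} {F F' G G' H φ a : Sph n → ℂ}

theorem IsSmooth.horizWord (hf : IsSmooth f) (w : List (Label n)) : IsSmooth (horizWord w f) :=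
  coe_wordEnd_apply w ⟨f, hf⟩ ▸ (wordEnd w ⟨f, hf⟩).2

theorem horizWord_append (v w : List (Label n)) (f : Sph n → ℂ) :
    horizWord (v ++ w) f = horizWord v (horizWord w f) :=
  List.foldr_append

theorem horizWord_star (w : List (Label n)) (f : Sph n → ℂ) :
    horizWord w (star f) = star (horizWord (w.map Label.conj) f) :=
  foldr_star horiz_star w f

theorem IsWeakDeriv.memLp (h : IsWeakDeriv w F G) : MemLp F 2 (vol n) :=
  h.1

theorem IsWeakDeriv.memLp_deriv (h : IsWeakDeriv w F G) : MemLp G 2 (vol n) :=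
  h.2.1

theorem IsWeakDeriv.integral_eq (h : IsWeakDeriv w F G) (hφ : IsSmooth φ) :
    ∫ ξ, G ξ * φ ξ ∂(vol n) = (-1) ^ w.length * ∫ ξ, F ξ * horizWord w.reverse φ ξ ∂(vol n) :=
  h.2.2 φ hφ

theorem isWeakDeriv_horizWord (hf : IsSmooth f) (w : List (Label n)) :
    IsWeakDeriv w f (horizWord w f) := by
  refine ⟨hf.memLp 2, (hf.horizWord w).memLp 2, fun φ hφ => ?_⟩
  have h := integralForm_wordEnd w ⟨φ, hφ⟩ ⟨f, hf⟩
  rw [integralForm_apply, integralForm_apply, coe_wordEnd_apply, coe_wordEnd_apply] at h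
  simpa only [mul_comm] using h

theorem IsWeakDeriv.add (h : IsWeakDeriv w F G) (h' : IsWeakDeriv w F' G') :
    IsWeakDeriv w (F + F') (G + G') := by
  refine ⟨h.memLp.add h'.memLp, h.memLp_deriv.add h'.memLp_deriv, fun φ hφ => ?_⟩
  have hw := (hφ.horizWord w.reverse).memLp 2
  rw [integral_add_mul_of_memLp h.memLp_deriv h'.memLp_deriv (hφ.memLp 2),
    integral_add_mul_of_memLp h.memLp h'.memLp hw, h.integral_eq hφ, h'.integral_eq hφ, mul_add]

theorem IsWeakDeriv.const_smul (c : ℂ) (h : IsWeakDeriv w F G) :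
    IsWeakDeriv w (c • F) (c • G) := by
  refine ⟨h.memLp.const_smul c, h.memLp_deriv.const_smul c, fun φ hφ => ?_⟩
  simp only [Pi.smul_apply, smul_eq_mul, mul_assoc]
  rw [integral_const_mul, integral_const_mul, h.integral_eq hφ, mul_left_comm]

theorem IsWeakDeriv.star (h : IsWeakDeriv (w.map Label.conj) F G) :
    IsWeakDeriv w (star F) (star G) := by
  refine ⟨h.memLp.star, h.memLp_deriv.star, fun φ hφ => ?_⟩
  have hconj : (w.map Label.conj).reverse.map Label.conj = w.reverse := by
    simp [← List.map_reverse, Function.comp_def, Label.conj_conj]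
  have hint := congrArg (starRingEnd ℂ) (h.integral_eq hφ.star)
  rw [horizWord_star, hconj, map_mul, ← integral_conj, ← integral_conj] at hint
  simpa using hint

theorem IsWeakDeriv.append_singleton {x : Label n} (h : IsWeakDeriv [x] F G)
    (h' : IsWeakDeriv w G H) : IsWeakDeriv (w ++ [x]) F H := by
  refine ⟨h.memLp, h'.memLp_deriv, fun φ hφ => ?_⟩
  rw [h'.integral_eq hφ, h.integral_eq (hφ.horizWord _), List.reverse_append, List.length_append,
    pow_add, mul_assoc, horizWord_append]

theorem IsWeakDeriv.of_cons {x : Label n} (h : IsWeakDeriv v F G)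
    (h' : IsWeakDeriv (x :: v) F H) : IsWeakDeriv [x] G H := by
  refine ⟨h.memLp_deriv, h'.memLp_deriv, fun φ hφ => ?_⟩
  rw [List.reverse_singleton, h.integral_eq (hφ.horizWord [x]), h'.integral_eq hφ,
    List.reverse_cons, horizWord_append, List.length_cons, pow_succ', mul_assoc,
    List.length_singleton, pow_one]

theorem IsSmooth.memLp_mul (ha : IsSmooth a) (hF : MemLp F 2 (vol n)) :
    MemLp (a * F) 2 (vol n) :=
  hF.mul (ha.memLp ⊤)

theorem IsWeakDeriv.smooth_mul {x : Label n} (ha : IsSmooth a) (h : IsWeakDeriv [x] F G) :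
    IsWeakDeriv [x] (a * F) (a * G + horiz x a * F) := by
  have haG := ha.memLp_mul h.memLp_deriv
  have hxF := (ha.horiz x).memLp_mul h.memLp
  refine ⟨ha.memLp_mul h.memLp, haG.add hxF, fun φ hφ => ?_⟩
  have hGφ : ∫ ξ, G ξ * (a * φ) ξ ∂(vol n) = -∫ ξ, F ξ * horiz x (a * φ) ξ ∂(vol n) := by
    simpa using! h.integral_eq (ha.mul hφ)
  change _ = (-1) ^ 1 * ∫ ξ, (a * F) ξ * horiz x φ ξ ∂(vol n)
  simp only [horiz_mul x ha hφ, mul_comm (F _)] at hGφ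
  rw [integral_add_mul_of_memLp ((ha.mul (hφ.horiz x)).memLp 2)
    (((ha.horiz x).mul hφ).memLp 2) h.memLp] at hGφ
  rw [integral_add_mul_of_memLp haG hxF (hφ.memLp 2)]
  simp only [Pi.mul_apply, mul_comm, mul_left_comm] at hGφ ⊢
  linear_combination hGφ

theorem IsWeakDeriv.mul_congr_nil (ha : IsSmooth a) (h : IsWeakDeriv [] F G)
    (hH : IsWeakDeriv w (a * G) H) : IsWeakDeriv w (a * F) H := by
  refine ⟨ha.memLp_mul h.memLp, hH.memLp_deriv, fun φ hφ => ?_⟩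
  have hint := h.integral_eq (ha.mul (hφ.horizWord w.reverse))
  rw [List.length_nil, pow_zero, one_mul, List.reverse_nil] at hint
  rw [hH.integral_eq hφ]
  simp only [Pi.mul_apply, mul_comm (a _), mul_assoc] at hint ⊢
  rw [hint]
  simp only [horizWord, List.foldr_nil, Pi.mul_apply, mul_comm (a _)]

/-- The `L²` norm of the weak derivative `X_w F`, and `∞` if it does not exist. -/
def wordNorm (w : List (Label n)) (F : Sph n → ℂ) : ℝ≥0∞ :=
  ⨅ (G : Sph n → ℂ) (_ : IsWeakDeriv w F G), eLpNorm G 2 (vol n)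

theorem fsNorm_eq_sum_wordNorm (k : ℕ) (F : Sph n → ℂ) : fsNorm k F =
    ∑ m ∈ Finset.range (k + 1), ∑ x : Fin m → Label n, wordNorm (List.ofFn x) F :=
  rfl

theorem IsWeakDeriv.wordNorm_le (h : IsWeakDeriv w F G) : wordNorm w F ≤ eLpNorm G 2 (vol n) :=
  iInf₂_le G h

theorem wordNorm_le_fsNorm (hw : w.length ≤ k) (F : Sph n → ℂ) : wordNorm w F ≤ fsNorm k F :=
  calc wordNorm w F = wordNorm (List.ofFn w.get) F := by rw [List.ofFn_get]
    _ ≤ ∑ x : Fin w.length → Label n, wordNorm (List.ofFn x) F :=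
      Finset.single_le_sum (f := fun x : Fin w.length → Label n => wordNorm (List.ofFn x) F)
        (fun _ _ => zero_le) (Finset.mem_univ w.get)
    _ ≤ fsNorm k F :=
      Finset.single_le_sum (f := fun m => ∑ x : Fin m → Label n, wordNorm (List.ofFn x) F)
        (fun _ _ => zero_le) (Finset.mem_range_succ_iff.mpr hw)

theorem fsNorm_le_sum_mul {C : List (Label n) → ℝ≥0∞} {N : ℝ≥0∞}
    (h : ∀ w : List (Label n), w.length ≤ k → wordNorm w F ≤ C w * N) :
    fsNorm k F ≤ (∑ m ∈ Finset.range (k + 1), ∑ x : Fin m → Label n, C (List.ofFn x)) * N := by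
  simp only [fsNorm_eq_sum_wordNorm, Finset.sum_mul]
  refine Finset.sum_le_sum fun m hm => Finset.sum_le_sum fun x _ => h _ ?_
  rw [List.length_ofFn]
  exact Finset.mem_range_succ_iff.mp hm

theorem eLpNorm_horizWord_le_of_isWeakDeriv (hf : IsSmooth f) (hG : IsWeakDeriv w f G) :
    eLpNorm (horizWord w f) 2 (vol n) ≤ eLpNorm G 2 (vol n) := by
  set f' := horizWord w f
  have hf' : IsSmooth f' := hf.horizWord w
  have hint : ∫ ξ, G ξ * star f' ξ ∂(vol n) = ∫ ξ, f' ξ * star (f' ξ) ∂(vol n) :=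
    (hG.integral_eq hf'.star).trans ((isWeakDeriv_horizWord hf w).integral_eq hf'.star).symm
  have hCS := norm_integral_mul_le hG.memLp_deriv (hf'.star.memLp 2)
  rw [hint, norm_integral_mul_star_self (hf'.memLp 2), eLpNorm_star, sq] at hCS
  rw [← ENNReal.toReal_le_toReal (hf'.memLp 2).2.ne hG.memLp_deriv.2.ne]
  by_contra! hlt
  exact hlt.not_ge (le_of_mul_le_mul_right hCS (ENNReal.toReal_nonneg.trans_lt hlt))

theorem wordNorm_of_isSmooth (hf : IsSmooth f) (w : List (Label n)) :
    wordNorm w f = eLpNorm (horizWord w f) 2 (vol n) :=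
  le_antisymm (isWeakDeriv_horizWord hf w).wordNorm_le
    (le_iInf₂ fun _ hG => eLpNorm_horizWord_le_of_isWeakDeriv hf hG)

theorem IsSmooth.fsNorm_ne_top (hf : IsSmooth f) (k : ℕ) : fsNorm k f ≠ ⊤ := by
  rw [fsNorm_eq_sum_wordNorm]
  refine (ENNReal.sum_lt_top.mpr fun m _ => ENNReal.sum_lt_top.mpr fun x _ => ?_).ne
  rw [wordNorm_of_isSmooth hf]
  exact ((hf.horizWord _).memLp 2).2

theorem toReal_eLpNorm_horizWord_le (hf : IsSmooth f) (hw : w.length ≤ k) :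
    (eLpNorm (horizWord w f) 2 (vol n)).toReal ≤ (fsNorm k f).toReal := by
  rw [← wordNorm_of_isSmooth hf w]
  exact ENNReal.toReal_mono (hf.fsNorm_ne_top k) (wordNorm_le_fsNorm hw f)

theorem wordNorm_add_le (w : List (Label n)) (F F' : Sph n → ℂ) :
    wordNorm w (F + F') ≤ wordNorm w F + wordNorm w F' := by
  simp only [wordNorm, ENNReal.iInf_add, ENNReal.add_iInf, le_iInf_iff]
  intro G' hG' G hG
  exact (hG.add hG').wordNorm_le.trans
    (eLpNorm_add_le hG.memLp_deriv.1 hG'.memLp_deriv.1 one_le_two)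

theorem wordNorm_const_smul_le (w : List (Label n)) (c : ℂ) (F : Sph n → ℂ) :
    wordNorm w (c • F) ≤ ‖c‖ₑ * wordNorm w F := by
  rcases eq_or_ne c 0 with rfl | hc
  · have hzero : IsWeakDeriv w (0 : Sph n → ℂ) 0 := ⟨.zero, .zero, fun _ _ => by simp⟩
    simpa using hzero.wordNorm_le
  · have hc' : ‖c‖ₑ ≠ 0 := enorm_ne_zero.mpr hc
    simp only [wordNorm, ENNReal.mul_iInf_of_ne hc' enorm_ne_top, ← eLpNorm_const_smul]
    exact le_iInf₂ fun G hG => (hG.const_smul c).wordNorm_le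

theorem wordNorm_star_le (w : List (Label n)) (F : Sph n → ℂ) :
    wordNorm w (star F) ≤ wordNorm (w.map Label.conj) F :=
  le_iInf₂ fun G hG => hG.star.wordNorm_le.trans (eLpNorm_star G 2 (vol n)).le

theorem fsNorm_add_le (k : ℕ) (F F' : Sph n → ℂ) :
    fsNorm k (F + F') ≤ fsNorm k F + fsNorm k F' := by
  simp only [fsNorm_eq_sum_wordNorm, ← Finset.sum_add_distrib]
  exact Finset.sum_le_sum fun m _ => Finset.sum_le_sum fun x _ => wordNorm_add_le _ F F'

theorem fsNorm_const_smul_le (k : ℕ) (c : ℂ) (F : Sph n → ℂ) :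
    fsNorm k (c • F) ≤ ‖c‖ₑ * fsNorm k F := by
  simp only [fsNorm_eq_sum_wordNorm, Finset.mul_sum]
  exact Finset.sum_le_sum fun m _ => Finset.sum_le_sum fun x _ => wordNorm_const_smul_le _ c F

theorem fsNorm_sub_comm (k : ℕ) (F F' : Sph n → ℂ) : fsNorm k (F - F') = fsNorm k (F' - F) :=
  le_antisymm (by simpa using fsNorm_const_smul_le k (-1) (F' - F))
    (by simpa using fsNorm_const_smul_le k (-1) (F - F'))

theorem fsNorm_star_le (k : ℕ) (F : Sph n → ℂ) : fsNorm k (star F) ≤ fsNorm k F := by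
  refine Finset.sum_le_sum fun m _ => ?_
  have hconj : Function.Involutive fun (x : Fin m → Label n) i => (x i).conj := fun x =>
    funext fun i => (x i).conj_conj
  refine (Finset.sum_le_sum fun x _ => ?_).trans
    (Equiv.sum_comp hconj.toPerm fun x => wordNorm (List.ofFn x) F).le
  exact (wordNorm_star_le _ F).trans_eq (by rw [List.map_ofFn]; rfl)

theorem exists_isWeakDeriv_of_fsNorm_lt {ε : ℝ≥0∞} (hF : fsNorm k F < ε) :
    ∃ G : List (Label n) → Sph n → ℂ, ∀ w : List (Label n), w.length ≤ k →
      IsWeakDeriv w F (G w) ∧ eLpNorm (G w) 2 (vol n) ≤ ε := by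
  have hex (w : List (Label n)) : ∃ G, w.length ≤ k →
      IsWeakDeriv w F G ∧ eLpNorm G 2 (vol n) ≤ ε := by
    by_cases hw : w.length ≤ k
    · have hlt := (wordNorm_le_fsNorm hw F).trans_lt hF
      simp only [wordNorm, iInf_lt_iff] at hlt
      obtain ⟨G, hG, hGε⟩ := hlt
      exact ⟨G, fun _ => ⟨hG, hGε.le⟩⟩
    · exact ⟨0, fun h => absurd h hw⟩
  choose G hG using hex
  exact ⟨G, hG⟩

theorem exists_isWeakDeriv_smooth_mul (w : List (Label n)) (ha : IsSmooth a) :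
    ∃ C : ℝ≥0∞, C ≠ 0 ∧ C ≠ ⊤ ∧
      ∀ (k : ℕ) (F : Sph n → ℂ) (G : List (Label n) → Sph n → ℂ) (ε : ℝ≥0∞),
        (∀ v : List (Label n), v.length ≤ k →
          IsWeakDeriv v F (G v) ∧ eLpNorm (G v) 2 (vol n) ≤ ε) →
        ∀ v : List (Label n), w.length + v.length ≤ k →
          ∃ H, IsWeakDeriv w (a * G v) H ∧ eLpNorm H 2 (vol n) ≤ C * ε := by
  induction w using List.reverseRecOn generalizing a with
  | nil =>
    obtain ⟨C, hC, haC⟩ := ha.exists_norm_le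
    refine ⟨ENNReal.ofReal C, by simpa using hC, ENNReal.ofReal_ne_top,
      fun k F G ε hG v hv => ?_⟩
    obtain ⟨hv', hGε⟩ := hG v (by simpa using hv)
    have haG := ha.memLp_mul hv'.memLp_deriv
    refine ⟨a * G v, ⟨haG, haG, fun φ _ => by simp [horizWord]⟩, ?_⟩
    refine (eLpNorm_le_mul_eLpNorm_of_ae_le_mul (g := G v) (.of_forall fun ξ => ?_) 2).trans
      (by gcongr)
    rw [Pi.mul_apply, norm_mul]
    gcongr
    exact haC ξ
  | append_singleton w x ih =>
    obtain ⟨C₁, hC₁, hC₁', h₁⟩ := ih ha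
    obtain ⟨C₂, -, hC₂', h₂⟩ := ih (ha.horiz x)
    refine ⟨C₁ + C₂, by simp [hC₁], ENNReal.add_ne_top.mpr ⟨hC₁', hC₂'⟩,
      fun k F G ε hG v hv => ?_⟩
    rw [List.length_append, List.length_singleton] at hv
    have hxv : (x :: v).length ≤ k := by rw [List.length_cons]; omega
    obtain ⟨H₁, hH₁, hn₁⟩ := h₁ k F G ε hG (x :: v) (by rw [List.length_cons]; omega)
    obtain ⟨H₂, hH₂, hn₂⟩ := h₂ k F G ε hG v (by omega)
    have hx : IsWeakDeriv [x] (G v) (G (x :: v)) :=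
      (hG v (by omega)).1.of_cons (hG (x :: v) hxv).1
    refine ⟨H₁ + H₂, (hx.smooth_mul ha).append_singleton (hH₁.add hH₂), ?_⟩
    rw [add_mul]
    exact (eLpNorm_add_le hH₁.memLp_deriv.1 hH₂.memLp_deriv.1 one_le_two).trans
      (add_le_add hn₁ hn₂)

theorem exists_wordNorm_smooth_mul_le (w : List (Label n)) (ha : IsSmooth a) :
    ∃ C : ℝ≥0∞, C ≠ ⊤ ∧ ∀ k, w.length ≤ k → ∀ F, wordNorm w (a * F) ≤ C * fsNorm k F := by
  obtain ⟨C, hC, hC', h⟩ := exists_isWeakDeriv_smooth_mul w ha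
  refine ⟨C, hC', fun k hw F => ?_⟩
  refine ENNReal.le_mul_of_forall_lt (.inl hC) (.inl hC') fun c hc ε hε => ?_
  obtain ⟨G, hG⟩ := exists_isWeakDeriv_of_fsNorm_lt hε
  obtain ⟨H, hH, hHε⟩ := h k F G ε hG [] (by simpa using hw)
  exact (((hG [] k.zero_le).1.mul_congr_nil ha hH).wordNorm_le.trans hHε).trans (by gcongr)

theorem IsSmooth.exists_fsNorm_mul_le (ha : IsSmooth a) (k : ℕ) :
    ∃ C : ℝ≥0∞, C ≠ ⊤ ∧ ∀ F, fsNorm k (a * F) ≤ C * fsNorm k F := by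
  choose C hC h using fun w : List (Label n) => exists_wordNorm_smooth_mul_le w ha
  exact ⟨_, (ENNReal.sum_lt_top.mpr fun m _ => ENNReal.sum_lt_top.mpr fun x _ =>
    (hC _).lt_top).ne, fun F => fsNorm_le_sum_mul fun w hw => h w k hw F⟩

theorem norm_integralForm_wordEnd_mul_le (hv : v.length ≤ k) (hw : w.length ≤ k)
    (f g : smoothFun n) : ‖integralForm n f ((wordEnd v * wordEnd w) g)‖ ≤
      (fsNorm k (f : Sph n → ℂ)).toReal * (fsNorm k (g : Sph n → ℂ)).toReal := by
  rw [Module.End.mul_apply, integralForm_wordEnd, norm_mul, norm_pow, norm_neg, norm_one, one_pow,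
    one_mul, integralForm_apply, coe_wordEnd_apply, coe_wordEnd_apply]
  refine (norm_integral_mul_le ((f.2.horizWord _).memLp 2) ((g.2.horizWord _).memLp 2)).trans ?_
  exact mul_le_mul (toReal_eLpNorm_horizWord_le f.2 (by rwa [List.length_reverse]))
    (toReal_eLpNorm_horizWord_le g.2 hw) ENNReal.toReal_nonneg ENNReal.toReal_nonneg

theorem exists_norm_integralForm_le {O : Module.End ℂ (smoothFun n)}
    (hO : O ∈ horizOrder n (2 * k)) : ∃ C : ℝ, ∀ f g : smoothFun n, ‖integralForm n f (O g)‖ ≤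
      C * ((fsNorm k (f : Sph n → ℂ)).toReal * (fsNorm k (g : Sph n → ℂ)).toReal) := by
  induction hO using Submodule.span_induction with
  | mem O hO =>
    obtain ⟨w, hw, rfl⟩ := hO
    refine ⟨1, fun f g => ?_⟩
    rw [one_mul, ← List.take_append_drop k w, wordEnd_append]
    refine norm_integralForm_wordEnd_mul_le (List.length_take_le k w) ?_ f g
    rw [List.length_drop]
    have : w.length ≤ 2 * k := hw
    omega
  | zero => exact ⟨0, fun f g => by simp⟩
  | add O₁ O₂ _ _ h₁ h₂ =>
    obtain ⟨C₁, hC₁⟩ := h₁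
    obtain ⟨C₂, hC₂⟩ := h₂
    refine ⟨C₁ + C₂, fun f g => ?_⟩
    rw [LinearMap.add_apply, map_add, add_mul]
    exact (norm_add_le _ _).trans (add_le_add (hC₁ f g) (hC₂ f g))
  | smul c O _ h =>
    obtain ⟨C, hC⟩ := h
    refine ⟨‖c‖ * C, fun f g => ?_⟩
    rw [LinearMap.smul_apply, map_smul, norm_smul, mul_assoc]
    exact mul_le_mul_of_nonneg_left (hC f g) (norm_nonneg c)

end FollandStein

/-! ### The Folland–Stein space and the pairing -/

section Pairing

variable {k : ℕ} {F G H φ φ' ψ ψ' a : Sph n → ℂ}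

theorem hasBasis_smoothNhds (k : ℕ) (F : Sph n → ℂ) : (smoothNhds k F).HasBasis (0 < ·)
    fun ε => {φ | IsSmooth φ ∧ fsNorm k (φ - F) < ε} := by
  refine hasBasis_biInf_principal' (fun ε hε δ hδ => ⟨min ε δ, lt_min hε hδ, ?_, ?_⟩) ⟨1, one_pos⟩
  · exact fun φ hφ => ⟨hφ.1, hφ.2.trans_le (min_le_left ε δ)⟩
  · exact fun φ hφ => ⟨hφ.1, hφ.2.trans_le (min_le_right ε δ)⟩

theorem neBot_smoothNhds_iff : (smoothNhds k F).NeBot ↔ MemFS k F :=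
  (hasBasis_smoothNhds k F).neBot_iff

theorem eventually_isSmooth (k : ℕ) (F : Sph n → ℂ) : ∀ᶠ φ in smoothNhds k F, IsSmooth φ :=
  mem_of_superset ((hasBasis_smoothNhds k F).mem_of_mem one_pos) fun _ hφ => hφ.1

theorem tendsto_fsNorm_sub (k : ℕ) (F : Sph n → ℂ) :
    Tendsto (fun φ => fsNorm k (φ - F)) (smoothNhds k F) (𝓝 0) :=
  ENNReal.nhds_zero_basis.tendsto_right_iff.mpr fun _ hε =>
    mem_of_superset ((hasBasis_smoothNhds k F).mem_of_mem hε) fun _ hφ => hφ.2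

theorem tendsto_smoothNhds {ι : Type*} {l : Filter ι} {T : ι → Sph n → ℂ}
    (hT : ∀ᶠ i in l, IsSmooth (T i)) (hlim : Tendsto (fun i => fsNorm k (T i - F)) l (𝓝 0)) :
    Tendsto T l (smoothNhds k F) :=
  (hasBasis_smoothNhds k F).tendsto_right_iff.mpr fun _ hε =>
    hT.and (hlim.eventually (gt_mem_nhds hε))

theorem tendsto_smoothNhds_of_le {T : (Sph n → ℂ) → Sph n → ℂ} {C : ℝ≥0∞} (hC : C ≠ ⊤)
    (hT : ∀ φ, IsSmooth φ → IsSmooth (T φ))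
    (hle : ∀ φ, fsNorm k (T φ - G) ≤ C * fsNorm k (φ - F)) :
    Tendsto T (smoothNhds k F) (smoothNhds k G) :=
  tendsto_smoothNhds ((eventually_isSmooth k F).mono hT)
    (tendsto_of_tendsto_of_tendsto_of_le_of_le tendsto_const_nhds
      (by simpa using ENNReal.Tendsto.const_mul (tendsto_fsNorm_sub k F) (.inr hC))
      (fun _ => zero_le) hle)

theorem tendsto_add_smoothNhds (k : ℕ) (F G : Sph n → ℂ) :
    Tendsto (fun q : (Sph n → ℂ) × (Sph n → ℂ) => q.1 + q.2)
      (smoothNhds k F ×ˢ smoothNhds k G) (smoothNhds k (F + G)) := by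
  refine tendsto_smoothNhds ?_ ?_
  · filter_upwards [(eventually_isSmooth k F).prod_mk (eventually_isSmooth k G)] with q hq
    exact hq.1.add hq.2
  · have hlim := ((tendsto_fsNorm_sub k F).comp tendsto_fst).add
      ((tendsto_fsNorm_sub k G).comp (tendsto_snd (f := smoothNhds k F)))
    rw [add_zero] at hlim
    refine tendsto_of_tendsto_of_tendsto_of_le_of_le tendsto_const_nhds hlim
      (fun _ => zero_le) fun q => ?_
    rw [add_sub_add_comm]
    exact fsNorm_add_le k _ _

theorem tendsto_const_smul_smoothNhds (k : ℕ) (c : ℂ) (F : Sph n → ℂ) :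
    Tendsto (c • ·) (smoothNhds k F) (smoothNhds k (c • F)) :=
  tendsto_smoothNhds_of_le (C := ‖c‖ₑ) enorm_ne_top (fun _ hφ => hφ.const_smul c) fun φ => by
    rw [← smul_sub]
    exact fsNorm_const_smul_le k c _

theorem tendsto_star_smoothNhds (k : ℕ) (F : Sph n → ℂ) :
    Tendsto star (smoothNhds k F) (smoothNhds k (star F)) :=
  tendsto_smoothNhds_of_le ENNReal.one_ne_top (fun _ hφ => hφ.star) fun φ => by
    rw [← star_sub, one_mul]
    exact fsNorm_star_le k _

theorem tendsto_mul_smoothNhds (ha : IsSmooth a) (k : ℕ) (F : Sph n → ℂ) :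
    Tendsto (a * ·) (smoothNhds k F) (smoothNhds k (a * F)) := by
  obtain ⟨C, hC, hle⟩ := ha.exists_fsNorm_mul_le k
  refine tendsto_smoothNhds_of_le hC (fun _ hφ => ha.mul hφ) fun φ => ?_
  rw [← mul_sub]
  exact hle _

theorem MemFS.neBot (hF : MemFS k F) : (smoothNhds k F).NeBot :=
  neBot_smoothNhds_iff.mpr hF

theorem MemFS.add (hF : MemFS k F) (hG : MemFS k G) : MemFS k (F + G) :=
  have := hF.neBot
  have := hG.neBot
  neBot_smoothNhds_iff.mp (tendsto_add_smoothNhds k F G).neBot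

theorem MemFS.const_smul (c : ℂ) (hF : MemFS k F) : MemFS k (c • F) :=
  have := hF.neBot
  neBot_smoothNhds_iff.mp (tendsto_const_smul_smoothNhds k c F).neBot

theorem MemFS.star (hF : MemFS k F) : MemFS k (star F) :=
  have := hF.neBot
  neBot_smoothNhds_iff.mp (tendsto_star_smoothNhds k F).neBot

theorem MemFS.smooth_mul (ha : IsSmooth a) (hF : MemFS k F) : MemFS k (a * F) :=
  have := hF.neBot
  neBot_smoothNhds_iff.mp (tendsto_mul_smoothNhds ha k F).neBot

theorem MemFS.fsNorm_ne_top (hF : MemFS k F) : fsNorm k F ≠ ⊤ := by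
  obtain ⟨φ, hφ, hlt⟩ := hF 1 one_pos
  have hle := fsNorm_add_le k φ (F - φ)
  rw [add_sub_cancel, fsNorm_sub_comm k F φ] at hle
  exact ne_top_of_le_ne_top (ENNReal.add_ne_top.mpr ⟨hφ.fsNorm_ne_top k, hlt.ne_top⟩) hle

theorem MemFS.isBoundedUnder_fsNorm (hF : MemFS k F) :
    IsBoundedUnder (· ≤ ·) (smoothNhds k F) fun φ => ‖(fsNorm k φ).toReal‖ := by
  refine ⟨(1 + fsNorm k F).toReal, eventually_map.mpr ?_⟩
  filter_upwards [(hasBasis_smoothNhds k F).mem_of_mem one_pos] with φ hφ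
  rw [Real.norm_of_nonneg ENNReal.toReal_nonneg]
  refine ENNReal.toReal_mono (ENNReal.add_ne_top.mpr ⟨ENNReal.one_ne_top, hF.fsNorm_ne_top⟩) ?_
  have hle := fsNorm_add_le k (φ - F) F
  rw [sub_add_cancel] at hle
  exact hle.trans (by gcongr; exact hφ.2.le)

theorem tendsto_toReal_fsNorm_sub {ι : Type*} {l : Filter ι} {φ φ' : ι → Sph n → ℂ}
    (hφ : Tendsto φ l (smoothNhds k F)) (hφ' : Tendsto φ' l (smoothNhds k F)) :
    Tendsto (fun i => (fsNorm k (φ i - φ' i)).toReal) l (𝓝 0) := by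
  have hlim := ((tendsto_fsNorm_sub k F).comp hφ).add ((tendsto_fsNorm_sub k F).comp hφ')
  rw [add_zero] at hlim
  refine (ENNReal.tendsto_toReal ENNReal.zero_ne_top).comp
    (tendsto_of_tendsto_of_tendsto_of_le_of_le tendsto_const_nhds hlim (fun _ => zero_le)
      fun i => ?_)
  have hle := fsNorm_add_le k (φ i - F) (F - φ' i)
  rwa [sub_add_sub_cancel, fsNorm_sub_comm k F] at hle

theorem MemFS.tendsto_toReal_fsNorm_sub_mul (hG : MemFS k G) {ι : Type*} {l : Filter ι}
    {φ φ' ψ : ι → Sph n → ℂ} (hφ : Tendsto φ l (smoothNhds k F))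
    (hφ' : Tendsto φ' l (smoothNhds k F)) (hψ : Tendsto ψ l (smoothNhds k G)) :
    Tendsto (fun i => (fsNorm k (φ i - φ' i)).toReal * (fsNorm k (ψ i)).toReal) l (𝓝 0) :=
  (tendsto_toReal_fsNorm_sub hφ hφ').zero_mul_isBoundedUnder_le
    (hψ.isBoundedUnder_comp hG.isBoundedUnder_fsNorm)

/-- The bilinear form `(φ, ψ) ↦ ∫ ψ P_k φ dξ` on smooth functions, whose continuous extension to
the Folland–Stein space is `gjmsPairing`. -/
def gjmsForm (k : ℕ) (φ ψ : Sph n → ℂ) : ℂ :=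
  ∫ ξ, ψ ξ * gjms k φ ξ ∂(vol n)

theorem gjmsForm_eq_integralForm (k : ℕ) (hφ : IsSmooth φ) (hψ : IsSmooth ψ) :
    gjmsForm k φ ψ = integralForm n ⟨ψ, hψ⟩ (gjmsEnd n k ⟨φ, hφ⟩) := by
  rw [integralForm_apply, coe_gjmsEnd_apply, gjmsForm]

theorem exists_norm_gjmsForm_le (hn : n ≠ 0) (k : ℕ) :
    ∃ C : ℝ, ∀ φ ψ : Sph n → ℂ, IsSmooth φ → IsSmooth ψ →
      ‖gjmsForm k φ ψ‖ ≤ C * ((fsNorm k φ).toReal * (fsNorm k ψ).toReal) := by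
  obtain ⟨C, hC⟩ := exists_norm_integralForm_le (gjmsEnd_mem_horizOrder hn k)
  refine ⟨C, fun φ ψ hφ hψ => ?_⟩
  rw [gjmsForm_eq_integralForm k hφ hψ, mul_comm (fsNorm k φ).toReal]
  exact hC ⟨ψ, hψ⟩ ⟨φ, hφ⟩

theorem gjmsForm_comm (k : ℕ) (hφ : IsSmooth φ) (hψ : IsSmooth ψ) :
    gjmsForm k φ ψ = gjmsForm k ψ φ := by
  rw [gjmsForm_eq_integralForm k hφ hψ, gjmsForm_eq_integralForm k hψ hφ,
    ← isTranspose_gjmsEnd n k, integralForm_apply, integralForm_apply]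
  simp only [mul_comm]

theorem gjmsForm_add_right (k : ℕ) (hφ : IsSmooth φ) (hψ : IsSmooth ψ) (hψ' : IsSmooth ψ') :
    gjmsForm k φ (ψ + ψ') = gjmsForm k φ ψ + gjmsForm k φ ψ' :=
  integral_add_mul_of_memLp (hψ.memLp 2) (hψ'.memLp 2) ((hφ.gjms k).memLp 2)

theorem gjmsForm_smul_right (k : ℕ) (c : ℂ) (φ ψ : Sph n → ℂ) :
    gjmsForm k φ (c • ψ) = c * gjmsForm k φ ψ := by
  simp only [gjmsForm, Pi.smul_apply, smul_eq_mul, mul_assoc]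
  exact integral_const_mul _ _

theorem gjmsForm_star (k : ℕ) (hφ : IsSmooth φ) (ψ : Sph n → ℂ) :
    gjmsForm k (star φ) (star ψ) = starRingEnd ℂ (gjmsForm k φ ψ) := by
  rw [gjmsForm, gjms_star k hφ, gjmsForm, ← integral_conj]
  simp

theorem gjmsForm_sub_gjmsForm (k : ℕ) (hφ : IsSmooth φ) (hφ' : IsSmooth φ') (hψ : IsSmooth ψ)
    (hψ' : IsSmooth ψ') : gjmsForm k φ ψ - gjmsForm k φ' ψ' =
      gjmsForm k (φ - φ') ψ + gjmsForm k φ' (ψ - ψ') := by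
  have hleft := gjmsForm_add_right k hψ (hφ.sub hφ') hφ'
  have hright := gjmsForm_add_right k hφ' (hψ.sub hψ') hψ'
  rw [sub_add_cancel, gjmsForm_comm k hψ hφ, gjmsForm_comm k hψ (hφ.sub hφ'),
    gjmsForm_comm k hψ hφ'] at hleft
  rw [sub_add_cancel] at hright
  linear_combination hleft + hright

theorem tendsto_dist_gjmsForm (hn : n ≠ 0) (hF : MemFS k F) (hG : MemFS k G) :
    Tendsto (fun q : ((Sph n → ℂ) × (Sph n → ℂ)) × ((Sph n → ℂ) × (Sph n → ℂ)) =>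
        dist (gjmsForm k q.1.1 q.1.2) (gjmsForm k q.2.1 q.2.2))
      ((smoothNhds k F ×ˢ smoothNhds k G) ×ˢ (smoothNhds k F ×ˢ smoothNhds k G)) (𝓝 0) := by
  obtain ⟨C, hC⟩ := exists_norm_gjmsForm_le hn k
  set l := smoothNhds k F ×ˢ smoothNhds k G
  have hφ : Tendsto (fun q : (_ × _) × (_ × _) => q.1.1) (l ×ˢ l) (smoothNhds k F) :=
    tendsto_fst.comp tendsto_fst
  have hψ : Tendsto (fun q : (_ × _) × (_ × _) => q.1.2) (l ×ˢ l) (smoothNhds k G) :=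
    tendsto_snd.comp tendsto_fst
  have hφ' : Tendsto (fun q : (_ × _) × (_ × _) => q.2.1) (l ×ˢ l) (smoothNhds k F) :=
    tendsto_fst.comp tendsto_snd
  have hψ' : Tendsto (fun q : (_ × _) × (_ × _) => q.2.2) (l ×ˢ l) (smoothNhds k G) :=
    tendsto_snd.comp tendsto_snd
  have hlim := ((hG.tendsto_toReal_fsNorm_sub_mul hφ hφ' hψ).add
    (hF.tendsto_toReal_fsNorm_sub_mul hψ hψ' hφ')).const_mul C
  rw [add_zero, mul_zero] at hlim
  refine squeeze_zero' (.of_forall fun _ => dist_nonneg) ?_ hlim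
  filter_upwards [hφ.eventually (eventually_isSmooth k F), hψ.eventually (eventually_isSmooth k G),
    hφ'.eventually (eventually_isSmooth k F), hψ'.eventually (eventually_isSmooth k G)]
    with q hφ hψ hφ' hψ'
  rw [dist_eq_norm, gjmsForm_sub_gjmsForm k hφ hφ' hψ hψ', mul_add,
    mul_comm (fsNorm k (q.1.2 - q.2.2)).toReal]
  exact (norm_add_le _ _).trans (add_le_add (hC _ _ (hφ.sub hφ') hψ) (hC _ _ hφ' (hψ.sub hψ')))

theorem tendsto_gjmsPairing (hn : n ≠ 0) (hF : MemFS k F) (hG : MemFS k G) {ι : Type*}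
    {l : Filter ι} {φ ψ : ι → Sph n → ℂ} (hφ : Tendsto φ l (smoothNhds k F))
    (hψ : Tendsto ψ l (smoothNhds k G)) :
    Tendsto (fun i => gjmsForm k (φ i) (ψ i)) l (𝓝 (gjmsPairing k F G)) := by
  have := hF.neBot
  have := hG.neBot
  refine (tendsto_nhds_limUnder (g := fun q : (Sph n → ℂ) × (Sph n → ℂ) =>
    gjmsForm k q.1 q.2) ?_).comp (hφ.prodMk hψ)
  rw [← cauchy_map_iff_exists_tendsto, cauchy_map_iff', Metric.uniformity_eq_comap_nhds_zero,
    tendsto_comap_iff]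
  exact tendsto_dist_gjmsForm hn hF hG

theorem gjmsPairing_comm (hn : n ≠ 0) (hF : MemFS k F) (hG : MemFS k G) :
    gjmsPairing k F G = gjmsPairing k G F := by
  have := hF.neBot
  have := hG.neBot
  refine tendsto_nhds_unique
    (tendsto_gjmsPairing hn hF hG tendsto_fst (tendsto_snd (f := smoothNhds k F)))
    ((tendsto_gjmsPairing hn hG hF tendsto_snd tendsto_fst).congr' ?_)
  filter_upwards [(eventually_isSmooth k F).prod_mk (eventually_isSmooth k G)] with q hq
  exact gjmsForm_comm k hq.2 hq.1

theorem gjmsPairing_add_right (hn : n ≠ 0) (hF : MemFS k F) (hG : MemFS k G) (hH : MemFS k H) :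
    gjmsPairing k F (G + H) = gjmsPairing k F G + gjmsPairing k F H := by
  have := hF.neBot
  have := hG.neBot
  have := hH.neBot
  have hfst : Tendsto Prod.fst (smoothNhds k F ×ˢ (smoothNhds k G ×ˢ smoothNhds k H))
    (smoothNhds k F) := tendsto_fst
  have hsnd : Tendsto Prod.snd (smoothNhds k F ×ˢ (smoothNhds k G ×ˢ smoothNhds k H))
    (smoothNhds k G ×ˢ smoothNhds k H) := tendsto_snd
  refine tendsto_nhds_unique (tendsto_gjmsPairing hn hF (hG.add hH) hfst
    ((tendsto_add_smoothNhds k G H).comp hsnd))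
    (((tendsto_gjmsPairing hn hF hG hfst (tendsto_fst.comp hsnd)).add
      (tendsto_gjmsPairing hn hF hH hfst (tendsto_snd.comp hsnd))).congr' ?_)
  filter_upwards [(eventually_isSmooth k F).prod_mk
    ((eventually_isSmooth k G).prod_mk (eventually_isSmooth k H))] with q ⟨hφ, hψ, hχ⟩
  exact (gjmsForm_add_right k hφ hψ hχ).symm

theorem gjmsPairing_smul_right (hn : n ≠ 0) (c : ℂ) (hF : MemFS k F) (hG : MemFS k G) :
    gjmsPairing k F (c • G) = c * gjmsPairing k F G := by
  have := hF.neBot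
  have := hG.neBot
  refine tendsto_nhds_unique (tendsto_gjmsPairing hn hF (hG.const_smul c) tendsto_fst
    ((tendsto_const_smul_smoothNhds k c G).comp (tendsto_snd (f := smoothNhds k F)))) ?_
  simp only [Function.comp_apply, gjmsForm_smul_right]
  exact (tendsto_gjmsPairing hn hF hG tendsto_fst tendsto_snd).const_mul c

theorem gjmsPairing_add_left (hn : n ≠ 0) (hF : MemFS k F) (hG : MemFS k G) (hH : MemFS k H) :
    gjmsPairing k (F + G) H = gjmsPairing k F H + gjmsPairing k G H := by
  rw [gjmsPairing_comm hn (hF.add hG) hH, gjmsPairing_add_right hn hH hF hG,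
    gjmsPairing_comm hn hH hF, gjmsPairing_comm hn hH hG]

theorem gjmsPairing_smul_left (hn : n ≠ 0) (c : ℂ) (hF : MemFS k F) (hG : MemFS k G) :
    gjmsPairing k (c • F) G = c * gjmsPairing k F G := by
  rw [gjmsPairing_comm hn (hF.const_smul c) hG, gjmsPairing_smul_right hn c hG hF,
    gjmsPairing_comm hn hG hF]

theorem gjmsPairing_sum_right (hn : n ≠ 0) {ι : Type*} (s : Finset ι) {G : ι → Sph n → ℂ}
    (hF : MemFS k F) (hG : ∀ i, MemFS k (G i)) :
    gjmsPairing k F (∑ i ∈ s, G i) = ∑ i ∈ s, gjmsPairing k F (G i) := by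
  classical
  have hmem (s : Finset ι) : MemFS k (∑ i ∈ s, G i) :=
    Finset.sum_induction G (MemFS k) (fun _ _ => MemFS.add) (by simpa using hF.const_smul 0)
      fun i _ => hG i
  induction s using Finset.induction_on with
  | empty => simpa using gjmsPairing_smul_right hn 0 hF hF
  | insert i s hi ih =>
    rw [Finset.sum_insert hi, Finset.sum_insert hi, gjmsPairing_add_right hn hF (hG i) (hmem s), ih]

theorem gjmsPairing_star (hn : n ≠ 0) (hF : MemFS k F) (hG : MemFS k G) :
    gjmsPairing k (star F) (star G) = starRingEnd ℂ (gjmsPairing k F G) := by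
  have := hF.neBot
  have := hG.neBot
  refine tendsto_nhds_unique (tendsto_gjmsPairing hn hF.star hG.star
    ((tendsto_star_smoothNhds k F).comp tendsto_fst)
    ((tendsto_star_smoothNhds k G).comp (tendsto_snd (f := smoothNhds k F))))
    (((Complex.continuous_conj.tendsto _).comp
      (tendsto_gjmsPairing hn hF hG tendsto_fst tendsto_snd)).congr' ?_)
  filter_upwards [(eventually_isSmooth k F).prod_mk (eventually_isSmooth k G)] with q hq
  exact (gjmsForm_star k hq.1 q.2).symm

end Pairing

/-! ### Second-order expansions -/

section Expansion

variable {α : Type*} [MeasurableSpace α] {μ : Measure α}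

theorem abs_one_add_rpow_isLittleO (p : ℝ) :
    (fun x : ℝ => |1 + x| ^ p - (1 + p * x + p * (p - 1) / 2 * x ^ 2)) =o[𝓝 0] (· ^ 2) := by
  have hpos : ∀ᶠ x : ℝ in 𝓝 0, 0 < 1 + x :=
    (continuous_const.add continuous_id).tendsto' 0 1 (add_zero 1) |>.eventually
      (lt_mem_nhds one_pos)
  have hnhds : 𝓝[Set.Ioi (-1)] (0 : ℝ) = 𝓝 0 := isOpen_Ioi.nhdsWithin_eq (by simp)
  have hderiv : (fun x : ℝ => p * ((1 + x) ^ (p - 1) - 1 - (p - 1) * x)) =o[𝓝 0] (· ^ 1) := by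
    have h := ((hasDerivAt_id (0 : ℝ)).const_add 1 |>.rpow_const (p := p - 1)
      (.inl (by simp))).isLittleO.const_mul_left p
    simpa [mul_comm] using h
  have hrpow := Convex.isLittleO_pow_succ_real (s := Set.Ioi (-1 : ℝ)) (x₀ := 0) (n := 1)
    (f := fun x : ℝ => (1 + x) ^ p - (1 + p * x + p * (p - 1) / 2 * x ^ 2))
    (f' := fun x : ℝ => p * ((1 + x) ^ (p - 1) - 1 - (p - 1) * x))
    (convex_Ioi _) (by simp) (fun x hx => ?_) (by simpa [hnhds] using hderiv)
  · rw [hnhds] at hrpow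
    refine hrpow.congr' ?_ (by simp)
    filter_upwards [hpos] with x hx
    simp [abs_of_pos hx]
  · have hx : 1 + x ≠ 0 := by linarith [Set.mem_Ioi.mp hx]
    refine HasDerivAt.hasDerivWithinAt ?_
    refine ((((hasDerivAt_id x).const_add 1).rpow_const (p := p) (.inl hx)).sub
      ((((hasDerivAt_id x).const_mul p).const_add 1).add
        (((hasDerivAt_id x).pow 2).const_mul (p * (p - 1) / 2)))).congr_deriv ?_
    simp only [id_eq, Nat.cast_ofNat]
    ring

section Remainder

variable {R : ℝ → ℝ} {f w : α → ℝ} {M : ℝ}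

theorem eventually_ae_norm_comp_mul_mul_le (hR : R =o[𝓝 0] (· ^ 2))
    (hM : ∀ᵐ x ∂μ, |f x| ≤ M) {ε : ℝ} (hε : 0 < ε) :
    ∀ᶠ t in 𝓝 0, ∀ᵐ x ∂μ, ‖R (t * f x) * w x‖ ≤ ε * ‖t ^ 2‖ * ‖w x‖ := by
  set K := max M 1
  have hK : 0 < K := lt_max_of_lt_right one_pos
  obtain ⟨δ, hδ, hball⟩ := Metric.eventually_nhds_iff.mp (hR.def (by positivity : 0 < ε / K ^ 2))
  filter_upwards [Metric.ball_mem_nhds (0 : ℝ) (by positivity : 0 < δ / K)] with t ht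
  filter_upwards [hM] with x hx
  have hfK : |f x| ≤ K := hx.trans (le_max_left M 1)
  have htf : |t * f x| ≤ |t| * K := by rw [abs_mul]; gcongr
  have ht' : |t| * K < δ := by rwa [mem_ball_zero_iff, Real.norm_eq_abs, lt_div_iff₀ hK] at ht
  rw [norm_mul]
  gcongr
  calc ‖R (t * f x)‖ ≤ ε / K ^ 2 * ‖(t * f x) ^ 2‖ := hball (by simpa using htf.trans_lt ht')
    _ = ε / K ^ 2 * |t * f x| ^ 2 := by rw [norm_pow, Real.norm_eq_abs]
    _ ≤ ε / K ^ 2 * (|t| * K) ^ 2 := by gcongr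
    _ = ε * ‖t ^ 2‖ := by rw [norm_pow, Real.norm_eq_abs]; field_simp

theorem eventually_integrable_comp_mul_mul (hR : R =o[𝓝 0] (· ^ 2)) (hRm : Measurable R)
    (hf : AEMeasurable f μ) (hM : ∀ᵐ x ∂μ, |f x| ≤ M) (hw : Integrable w μ) :
    ∀ᶠ t in 𝓝 0, Integrable (fun x => R (t * f x) * w x) μ := by
  filter_upwards [eventually_ae_norm_comp_mul_mul_le hR hM (w := w) one_pos] with t ht
  exact (hw.norm.const_mul _).mono'
    ((hRm.comp_aemeasurable (hf.const_mul t)).mul hw.aemeasurable).aestronglyMeasurable ht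

theorem integral_comp_mul_mul_isLittleO (hR : R =o[𝓝 0] (· ^ 2))
    (hM : ∀ᵐ x ∂μ, |f x| ≤ M) (hw : Integrable w μ) :
    (fun t => ∫ x, R (t * f x) * w x ∂μ) =o[𝓝 0] (· ^ 2) := by
  set W := ∫ x, ‖w x‖ ∂μ
  have hW : 0 < W + 1 :=
    add_pos_of_nonneg_of_pos (integral_nonneg fun x => norm_nonneg (w x)) one_pos
  refine Asymptotics.isLittleO_iff.mpr fun ε hε => ?_
  filter_upwards [eventually_ae_norm_comp_mul_mul_le hR hM (w := w) (div_pos hε hW)] with t ht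
  calc ‖∫ x, R (t * f x) * w x ∂μ‖ ≤ ∫ x, ε / (W + 1) * ‖t ^ 2‖ * ‖w x‖ ∂μ :=
        norm_integral_le_of_norm_le (hw.norm.const_mul _) ht
    _ = ε * ‖t ^ 2‖ * (W / (W + 1)) := by rw [integral_const_mul]; ring
    _ ≤ ε * ‖t ^ 2‖ :=
        mul_le_of_le_one_right (by positivity) (div_le_one_of_le₀ (by linarith) hW.le)

end Remainder

theorem integral_abs_one_add_mul_rpow_isLittleO {f w : α → ℝ} {M : ℝ} (p : ℝ)
    (hf : AEMeasurable f μ) (hM : ∀ᵐ x ∂μ, |f x| ≤ M) (hw : Integrable w μ) :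
    (fun t => (∫ x, |1 + t * f x| ^ p * w x ∂μ) -
      ((∫ x, w x ∂μ) + p * t * (∫ x, f x * w x ∂μ) +
        p * (p - 1) / 2 * t ^ 2 * ∫ x, f x ^ 2 * w x ∂μ)) =o[𝓝 0] (· ^ 2) := by
  have hR := abs_one_add_rpow_isLittleO p
  refine (integral_comp_mul_mul_isLittleO hR hM hw).congr' ?_ .rfl
  have hfw : Integrable (fun x => f x * w x) μ := hw.bdd_mul hf.aestronglyMeasurable hM
  have hffw : Integrable (fun x => f x ^ 2 * w x) μ := by
    simpa only [sq, mul_assoc] using hfw.bdd_mul hf.aestronglyMeasurable hM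
  filter_upwards [eventually_integrable_comp_mul_mul hR (by fun_prop) hf hM hw] with t ht
  have hpoly : Integrable (fun x => w x + p * t * (f x * w x) +
      p * (p - 1) / 2 * t ^ 2 * (f x ^ 2 * w x)) μ :=
    (hw.add (hfw.const_mul _)).add (hffw.const_mul _)
  rw [eq_sub_iff_add_eq, ← integral_const_mul, ← integral_const_mul,
    ← integral_add hw (hfw.const_mul _), ← integral_add _ (hffw.const_mul _),
    ← integral_add ht hpoly]
  · exact integral_congr_ae (.of_forall fun x => by ring)
  · exact hw.add (hfw.const_mul _)

section RpowExpansion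

variable {D : ℝ → ℝ} {b : ℝ}

theorem tendsto_one_of_isLittleO_sq
    (hD : (fun t => D t - (1 + b * t ^ 2)) =o[𝓝 0] fun t : ℝ => t ^ 2) :
    Tendsto D (𝓝 0) (𝓝 1) := by
  have hpoly : Tendsto (fun t : ℝ => 1 + b * t ^ 2) (𝓝 0) (𝓝 1) :=
    Continuous.tendsto' (by fun_prop) _ _ (by simp)
  have hsq : Tendsto (fun t : ℝ => t ^ 2) (𝓝 0) (𝓝 0) :=
    Continuous.tendsto' (by fun_prop) _ _ (by simp)
  simpa using (hD.isBigO.trans_tendsto hsq).add hpoly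

theorem rpow_sub_isLittleO_sq (r : ℝ)
    (hD : (fun t => D t - (1 + b * t ^ 2)) =o[𝓝 0] fun t : ℝ => t ^ 2) :
    (fun t => D t ^ r - (1 + r * b * t ^ 2)) =o[𝓝 0] fun t : ℝ => t ^ 2 := by
  have hD_one : (fun t => D t - 1) =O[𝓝 0] fun t : ℝ => t ^ 2 := by
    refine (hD.isBigO.add (Asymptotics.isBigO_const_mul_self b _ _)).congr_left fun t => ?_
    ring
  have hrpow := ((Real.hasDerivAt_rpow_const (x := 1) (p := r) (.inl one_ne_zero)).isLittleO
    |>.comp_tendsto (tendsto_one_of_isLittleO_sq hD)).trans_isBigO hD_one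
  refine (hrpow.add (hD.const_mul_left r)).congr_left fun t => ?_
  simp only [Function.comp_apply, Real.one_rpow, mul_one, smul_eq_mul]
  ring

/- Adding the inequalities at `t` and `-t` removes the linear term. -/
theorem mul_le_of_eventually_mul_le {A₀ A₁ A₂ : ℝ}
    (hD : (fun t => D t - (1 + b * t ^ 2)) =o[𝓝 0] fun t : ℝ => t ^ 2)
    (hle : ∀ᶠ t in 𝓝 0, A₀ * D t ≤ A₀ + t * A₁ + t ^ 2 * A₂) : A₀ * b ≤ A₂ := by
  have hneg : Tendsto (fun t : ℝ => -t) (𝓝 0) (𝓝 0) := by simpa using continuous_neg.tendsto (0 : ℝ)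
  have hneg_sq : (fun t => D (-t) - (1 + b * t ^ 2)) =o[𝓝 0] fun t : ℝ => t ^ 2 := by
    simpa [Function.comp_def] using hD.comp_tendsto hneg
  have hlim := (((hD.add hneg_sq).mono (nhdsWithin_le_nhds (s := {0}ᶜ))).tendsto_div_nhds_zero
    |>.const_mul A₀).add_const (2 * (A₀ * b))
  rw [mul_zero, zero_add] at hlim
  suffices h : 2 * (A₀ * b) ≤ 2 * A₂ by linarith
  refine le_of_tendsto hlim ?_
  filter_upwards [(hle.and (hneg.eventually hle)).filter_mono nhdsWithin_le_nhds,
    self_mem_nhdsWithin] with t ⟨hpos, hneg⟩ (ht : t ≠ 0)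
  have ht2 : 0 < t ^ 2 := by positivity
  rw [mul_div_assoc', ← le_sub_iff_add_le, div_le_iff₀ ht2]
  rw [neg_sq] at hneg
  linear_combination hpos + hneg

end RpowExpansion

end Expansion

/-! ### The energy and the constraint -/

section Functionals

variable {k : ℕ} {u v : Sph n → ℝ}

theorem toC_add (u v : Sph n → ℝ) : toC (u + v) = toC u + toC v := by
  ext ξ
  simp [toC]

theorem toC_smul (c : ℝ) (u : Sph n → ℝ) : toC (c • u) = (c : ℂ) • toC u := by
  ext ξ
  simp [toC]

theorem toC_mul (u v : Sph n → ℝ) : toC (u * v) = toC u * toC v := by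
  ext ξ
  simp [toC]

theorem star_toC (u : Sph n → ℝ) : star (toC u) = toC u := by
  ext ξ
  simp [toC]

theorem coe_energy (hn : n ≠ 0) (hu : MemFS k (toC u)) :
    (energy k u : ℂ) = gjmsPairing k (toC u) (toC u) := by
  have hconj := gjmsPairing_star hn hu hu
  rw [star_toC] at hconj
  exact Complex.conj_eq_iff_re.mp hconj.symm

theorem energy_smul (hn : n ≠ 0) (c : ℝ) (hu : MemFS k (toC u)) :
    energy k (c • u) = c ^ 2 * energy k u := by
  rw [energy, toC_smul, gjmsPairing_smul_left hn _ hu (hu.const_smul _),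
    gjmsPairing_smul_right hn _ hu hu, Complex.re_ofReal_mul, Complex.re_ofReal_mul, energy]
  ring

theorem energy_add_smul (hn : n ≠ 0) (t : ℝ) (hu : MemFS k (toC u)) (hv : MemFS k (toC v)) :
    energy k (u + t • v) =
      energy k u + t * (2 * (gjmsPairing k (toC u) (toC v)).re) + t ^ 2 * energy k v := by
  have htv : MemFS k ((t : ℂ) • toC v) := hv.const_smul _
  rw [← energy_smul hn t hv, energy, toC_add, toC_smul,
    gjmsPairing_add_left hn hu htv (hu.add htv), gjmsPairing_add_right hn hu hu htv,
    gjmsPairing_add_right hn htv hu htv, gjmsPairing_comm hn htv hu,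
    gjmsPairing_smul_right hn _ hu hv]
  simp only [energy, toC_smul, Complex.add_re, Complex.re_ofReal_mul]
  ring

theorem critExp_pos (hkn : k < n + 1) : 0 < critExp n k := by
  have : (k : ℝ) < n + 1 := mod_cast hkn
  exact div_pos (by positivity) (by linarith)

theorem constraint_smul (k : ℕ) (c : ℝ) (u : Sph n → ℝ) :
    constraint k (c • u) = |c| ^ critExp n k * constraint k u := by
  rw [constraint, constraint, ← integral_const_mul]
  simp only [Pi.smul_apply, smul_eq_mul, abs_mul, Real.mul_rpow (abs_nonneg _) (abs_nonneg _)]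

theorem constraint_normalize (hkn : k < n + 1) (hu : 0 < constraint k u) :
    constraint k (constraint k u ^ (-1 / critExp n k) • u) = 1 := by
  rw [constraint_smul, abs_of_pos (Real.rpow_pos_of_pos hu _), ← Real.rpow_mul hu.le,
    div_mul_cancel₀ _ (critExp_pos hkn).ne', Real.rpow_neg_one, inv_mul_cancel₀ hu.ne']

theorem constraint_add_smul_mul (k : ℕ) (t : ℝ) (f u : Sph n → ℝ) :
    constraint k (u + t • (f * u)) =
      ∫ ξ, |1 + t * f ξ| ^ critExp n k * |u ξ| ^ critExp n k ∂(vol n) := by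
  refine integral_congr_ae (.of_forall fun ξ => ?_)
  simp only [Pi.add_apply, Pi.smul_apply, Pi.mul_apply, smul_eq_mul]
  rw [← Real.mul_rpow (abs_nonneg _) (abs_nonneg _), ← abs_mul]
  ring_nf

theorem tendsto_fsNorm_smul_add_smul_sub (hu : MemFS k (toC u)) (hv : MemFS k (toC v))
    {c : ℝ → ℝ} (hc : Tendsto c (𝓝 0) (𝓝 1)) :
    Tendsto (fun t => fsNorm k (toC (c t • (u + t • v)) - toC u)) (𝓝 0) (𝓝 0) := by
  have henorm {b : ℝ → ℝ} (hb : Tendsto b (𝓝 0) (𝓝 0)) :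
      Tendsto (fun t => ‖(b t : ℂ)‖ₑ) (𝓝 0) (𝓝 0) := by
    simpa using ((Complex.continuous_ofReal.tendsto _).comp hb).enorm
  have hc_sub : Tendsto (fun t => c t - 1) (𝓝 0) (𝓝 0) := by simpa using hc.sub_const 1
  have hc_mul : Tendsto (fun t => c t * t) (𝓝 0) (𝓝 0) := by simpa using hc.mul tendsto_id
  have hlim := (ENNReal.Tendsto.mul_const (henorm hc_sub) (.inr hu.fsNorm_ne_top)).add
    (ENNReal.Tendsto.mul_const (henorm hc_mul) (.inr hv.fsNorm_ne_top))
  rw [zero_mul, zero_mul, add_zero] at hlim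
  refine tendsto_of_tendsto_of_tendsto_of_le_of_le tendsto_const_nhds hlim (fun _ => zero_le)
    fun t => ?_
  have hsplit : toC (c t • (u + t • v)) - toC u =
      ((c t - 1 : ℝ) : ℂ) • toC u + ((c t * t : ℝ) : ℂ) • toC v := by
    rw [toC_smul, toC_add, toC_smul]
    push_cast
    module
  rw [hsplit]
  exact (fsNorm_add_le k _ _).trans
    (add_le_add (fsNorm_const_smul_le k _ _) (fsNorm_const_smul_le k _ _))

end Functionals

/-! ### The second variation -/

section SecondVariation

variable {k : ℕ} {u v : Sph n → ℝ} {a : Sph n → ℂ}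

theorem IsLocalMinimizer.integrable_rpow (hmin : IsLocalMinimizer k u) :
    Integrable (fun ξ => |u ξ| ^ critExp n k) (vol n) :=
  not_imp_comm.mp integral_undef (hmin.2.1.trans_ne one_ne_zero)

theorem IsLocalMinimizer.eventually_energy_mul_rpow_le (hn : n ≠ 0) (hkn : k < n + 1)
    (hmin : IsLocalMinimizer k u) (hv : MemFS k (toC v))
    (hlim : Tendsto (fun t : ℝ => constraint k (u + t • v)) (𝓝 0) (𝓝 1)) :
    ∀ᶠ t : ℝ in 𝓝 0,
      energy k u * constraint k (u + t • v) ^ (2 / critExp n k) ≤ energy k (u + t • v) := by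
  obtain ⟨hu, -, ε, hε, hle⟩ := hmin
  have hscale : Tendsto (fun t : ℝ => constraint k (u + t • v) ^ (-1 / critExp n k)) (𝓝 0) (𝓝 1) :=
    by simpa using hlim.rpow_const (p := -1 / critExp n k) (.inl one_ne_zero)
  filter_upwards [hlim.eventually (lt_mem_nhds one_pos),
    (tendsto_fsNorm_smul_add_smul_sub hu hv hscale).eventually (gt_mem_nhds hε)] with t hpos hclose
  have hmem : MemFS k (toC (u + t • v)) := by
    rw [toC_add, toC_smul]
    exact hu.add (hv.const_smul _)
  have henergy := hle _ (by rw [toC_smul]; exact hmem.const_smul _)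
    (constraint_normalize hkn hpos) hclose
  rw [energy_smul hn _ hmem, ← Real.rpow_mul_natCast hpos.le] at henergy
  have hexp : -1 / critExp n k * (2 : ℕ) = -(2 / critExp n k) := by
    push_cast
    ring
  rwa [hexp, Real.rpow_neg hpos.le, inv_mul_eq_div, le_div_iff₀ (Real.rpow_pos_of_pos hpos _)]
    at henergy

theorem IsLocalMinimizer.second_variation (hn : n ≠ 0) (hkn : k < n + 1)
    (hmin : IsLocalMinimizer k u) {f : Sph n → ℝ} (hf : IsSmooth (toC f))
    (hbal : ∫ ξ, f ξ * |u ξ| ^ critExp n k ∂(vol n) = 0) :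
    (critExp n k - 1) * (∫ ξ, f ξ ^ 2 * |u ξ| ^ critExp n k ∂(vol n)) * energy k u ≤
      energy k (f * u) := by
  set p := critExp n k
  have hp : p ≠ 0 := (critExp_pos hkn).ne'
  have hfu : MemFS k (toC (f * u)) := toC_mul f u ▸ hmin.1.smooth_mul hf
  have hmeas : AEMeasurable f (vol n) :=
    (Complex.continuous_re.comp hf.continuous).measurable.aemeasurable
  obtain ⟨M, -, hM⟩ := hf.exists_norm_le
  have hexpand := integral_abs_one_add_mul_rpow_isLittleO p hmeas
    (.of_forall fun ξ => (Complex.norm_real (f ξ)).symm.trans_le (hM ξ)) hmin.integrable_rpow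
  have hconstraint : (fun t : ℝ => constraint k (u + t • (f * u)) -
      (1 + p * (p - 1) / 2 * (∫ ξ, f ξ ^ 2 * |u ξ| ^ p ∂(vol n)) * t ^ 2)) =o[𝓝 0] (· ^ 2) := by
    have hone : ∫ ξ, |u ξ| ^ p ∂(vol n) = 1 := hmin.2.1
    refine hexpand.congr_left fun t => ?_
    rw [constraint_add_smul_mul, hone, hbal]
    ring
  have hvariation := hmin.eventually_energy_mul_rpow_le hn hkn hfu
    (tendsto_one_of_isLittleO_sq hconstraint)
  simp only [energy_add_smul hn _ hmin.1 hfu] at hvariation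
  refine Eq.trans_le ?_
    (mul_le_of_eventually_mul_le (rpow_sub_isLittleO_sq (2 / p) hconstraint) hvariation)
  field_simp

theorem isSmooth_toC_re (ha : IsSmooth a) : IsSmooth (toC (Complex.re ∘ a)) := by
  have hre : toC (Complex.re ∘ a) = (1 / 2 : ℂ) • (a + star a) := by
    ext ξ
    simp [toC, Complex.re_eq_add_conj, div_eq_inv_mul]
  exact hre ▸ (ha.add ha.star).const_smul _

theorem isSmooth_toC_im (ha : IsSmooth a) : IsSmooth (toC (Complex.im ∘ a)) := by
  have him : toC (Complex.im ∘ a) = (1 / (2 * Complex.I) : ℂ) • (a - star a) := by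
    ext ξ
    simp [toC, Complex.im_eq_sub_conj, div_eq_inv_mul]
  exact him ▸ (ha.sub ha.star).const_smul _

theorem mul_toC_eq (a : Sph n → ℂ) (u : Sph n → ℝ) :
    a * toC u = toC (Complex.re ∘ a * u) + Complex.I • toC (Complex.im ∘ a * u) := by
  ext ξ
  apply Complex.ext <;> simp [toC]

theorem gjmsPairing_mul_star_mul (hn : n ≠ 0) (ha : IsSmooth a) (hu : MemFS k (toC u)) :
    gjmsPairing k (a * toC u) (star a * toC u) =
      ((energy k (Complex.re ∘ a * u) + energy k (Complex.im ∘ a * u) : ℝ) : ℂ) := by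
  have hX : MemFS k (toC (Complex.re ∘ a * u)) := toC_mul _ u ▸ hu.smooth_mul (isSmooth_toC_re ha)
  have hY : MemFS k (toC (Complex.im ∘ a * u)) := toC_mul _ u ▸ hu.smooth_mul (isSmooth_toC_im ha)
  have hstar : star a * toC u =
      toC (Complex.re ∘ a * u) + (-Complex.I) • toC (Complex.im ∘ a * u) := by
    ext ξ
    apply Complex.ext <;> simp [toC]
  have hmem := hX.add (hY.const_smul (-Complex.I))
  rw [mul_toC_eq, hstar, gjmsPairing_add_left hn hX (hY.const_smul _) hmem,
    gjmsPairing_smul_left hn _ hY hmem, gjmsPairing_add_right hn hX hX (hY.const_smul _),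
    gjmsPairing_add_right hn hY hX (hY.const_smul _), gjmsPairing_smul_right hn _ hX hY,
    gjmsPairing_smul_right hn _ hY hY, gjmsPairing_comm hn hY hX, Complex.ofReal_add,
    coe_energy hn hX, coe_energy hn hY]
  linear_combination
    (-gjmsPairing k (toC (Complex.im ∘ a * u)) (toC (Complex.im ∘ a * u))) * Complex.I_mul_I

theorem IsLocalMinimizer.integrable_sq_mul_rpow (hmin : IsLocalMinimizer k u) {f : Sph n → ℝ}
    (hf : Continuous f) : Integrable (fun ξ => f ξ ^ 2 * |u ξ| ^ critExp n k) (vol n) := by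
  obtain ⟨C, hC⟩ := isCompact_univ.exists_bound_of_continuousOn (hf.pow 2).continuousOn
  exact hmin.integrable_rpow.bdd_mul (hf.pow 2).aestronglyMeasurable
    (.of_forall fun ξ => hC ξ trivial)

theorem IsLocalMinimizer.second_variation_complex (hn : n ≠ 0) (hkn : k < n + 1)
    (hmin : IsLocalMinimizer k u) (ha : IsSmooth a)
    (hbal : ∫ ξ, a ξ * ((|u ξ| ^ critExp n k : ℝ) : ℂ) ∂(vol n) = 0) :
    (critExp n k - 1) * (∫ ξ, ‖a ξ‖ ^ 2 * |u ξ| ^ critExp n k ∂(vol n)) * energy k u ≤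
      energy k (Complex.re ∘ a * u) + energy k (Complex.im ∘ a * u) := by
  have hre : Continuous (Complex.re ∘ a) := Complex.continuous_re.comp ha.continuous
  have him : Continuous (Complex.im ∘ a) := Complex.continuous_im.comp ha.continuous
  obtain ⟨C, -, hC⟩ := ha.exists_norm_le
  have hint : Integrable (fun ξ => a ξ * ((|u ξ| ^ critExp n k : ℝ) : ℂ)) (vol n) :=
    hmin.integrable_rpow.ofReal.bdd_mul ha.continuous.aestronglyMeasurable (.of_forall hC)
  have hbal_re : ∫ ξ, (Complex.re ∘ a) ξ * |u ξ| ^ critExp n k ∂(vol n) = 0 := by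
    simpa [hbal] using integral_re hint
  have hbal_im : ∫ ξ, (Complex.im ∘ a) ξ * |u ξ| ^ critExp n k ∂(vol n) = 0 := by
    simpa [hbal] using integral_im hint
  have hnorm : ∫ ξ, ‖a ξ‖ ^ 2 * |u ξ| ^ critExp n k ∂(vol n) =
      (∫ ξ, (Complex.re ∘ a) ξ ^ 2 * |u ξ| ^ critExp n k ∂(vol n)) +
        ∫ ξ, (Complex.im ∘ a) ξ ^ 2 * |u ξ| ^ critExp n k ∂(vol n) := by
    rw [← integral_add (hmin.integrable_sq_mul_rpow hre) (hmin.integrable_sq_mul_rpow him)]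
    simp only [← add_mul, Function.comp_apply, Complex.sq_norm, Complex.normSq_apply, ← sq]
  rw [hnorm, mul_add, add_mul]
  exact add_le_add (hmin.second_variation hn hkn (isSmooth_toC_re ha) hbal_re)
    (hmin.second_variation hn hkn (isSmooth_toC_im ha) hbal_im)

variable {ι : Type*} [Fintype ι] {b : ι → Sph n → ℂ}

theorem sum_commPairing_eq (hn : n ≠ 0) (hu : MemFS k (toC u)) (hb : ∀ j, IsSmooth (b j))
    (hnorm : ∀ ξ, ∑ j, ‖b j ξ‖ ^ 2 = 1) :
    ∑ j, commPairing k (b j) (toC u) (star (b j) * toC u) =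
      ((∑ j, (energy k (Complex.re ∘ b j * u) + energy k (Complex.im ∘ b j * u)) - energy k u : ℝ)
        : ℂ) := by
  have hsum : ∑ j, b j * (star (b j) * toC u) = toC u := by
    ext ξ
    have hone : ∑ j, b j ξ * star (b j ξ) = 1 := by
      simpa [Complex.mul_conj'] using congrArg Complex.ofReal (hnorm ξ)
    simp only [Finset.sum_apply, Pi.mul_apply, Pi.star_apply, ← mul_assoc, ← Finset.sum_mul, hone,
      one_mul]
  simp only [commPairing, Finset.sum_sub_distrib, gjmsPairing_mul_star_mul hn (hb _) hu]
  rw [← gjmsPairing_sum_right hn _ hu fun j => (hu.smooth_mul (hb j).star).smooth_mul (hb j), hsum,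
    ← coe_energy hn hu]
  push_cast
  rfl

theorem IsLocalMinimizer.sum_energy_ge (hn : n ≠ 0) (hkn : k < n + 1)
    (hmin : IsLocalMinimizer k u) (hb : ∀ j, IsSmooth (b j)) (hnorm : ∀ ξ, ∑ j, ‖b j ξ‖ ^ 2 = 1)
    (hbal : ∀ j, ∫ ξ, b j ξ * ((|u ξ| ^ critExp n k : ℝ) : ℂ) ∂(vol n) = 0) :
    (critExp n k - 1) * energy k u ≤
      ∑ j, (energy k (Complex.re ∘ b j * u) + energy k (Complex.im ∘ b j * u)) := by
  have htotal : ∑ j, ∫ ξ, ‖b j ξ‖ ^ 2 * |u ξ| ^ critExp n k ∂(vol n) = 1 := by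
    rw [← integral_finsetSum _ fun j _ => hmin.integrable_sq_mul_rpow (hb j).continuous.norm]
    simp only [← Finset.sum_mul, hnorm, one_mul]
    exact hmin.2.1
  calc (critExp n k - 1) * energy k u
      = ∑ j, (critExp n k - 1) * (∫ ξ, ‖b j ξ‖ ^ 2 * |u ξ| ^ critExp n k ∂(vol n)) *
          energy k u := by
        rw [← Finset.sum_mul, ← Finset.mul_sum, htotal, mul_one]
    _ ≤ _ := Finset.sum_le_sum fun j _ => hmin.second_variation_complex hn hkn (hb j) (hbal j)

theorem sum_norm_sq_coord (ξ : Sph n) : ∑ j, ‖coord j ξ‖ ^ 2 = 1 := by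
  have hsq := EuclideanSpace.norm_sq_eq (ξ : Amb n)
  rw [mem_sphere_zero_iff_norm.mp ξ.2, one_pow] at hsq
  exact hsq.symm

end SecondVariation

end CRSphere

end

open CRSphere in
theorem proposition4p3_general {n k : ℕ} (hn : n ≠ 0) (hkn : k < n + 1) {u : Sph n → ℝ}
    (hmin : IsLocalMinimizer k u) {ι : Type*} [Fintype ι] {b : ι → Sph n → ℂ}
    (hb : ∀ j, IsSmooth (b j)) (hnorm : ∀ ξ, ∑ j, ‖b j ξ‖ ^ 2 = 1)
    (hbal : ∀ j, ∫ ξ, b j ξ * ((|u ξ| ^ critExp n k : ℝ) : ℂ) ∂(vol n) = 0) :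
    (∑ j, commPairing k (b j) (toC u) (star (b j) * toC u)).im = 0 ∧
    (gjmsPairing k (toC u) (toC u)).im = 0 ∧
    (∑ j, commPairing k (b j) (toC u) (star (b j) * toC u)).re ≥
      (critExp n k - 2) * (gjmsPairing k (toC u) (toC u)).re := by
  have hge := hmin.sum_energy_ge hn hkn hb hnorm hbal
  rw [sum_commPairing_eq hn hmin.1 hb hnorm, ← coe_energy hn hmin.1]
  refine ⟨Complex.ofReal_im _, Complex.ofReal_im _, ?_⟩
  rw [Complex.ofReal_re, Complex.ofReal_re]
  linarith

theorem proposition4p3 (n k : ℕ) (hk : 1 ≤ k) (hkn : k < n + 1)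
    (u : CRSphere.Sph n → ℝ)
    (hpos : ∀ᵐ ξ ∂(CRSphere.vol n), 0 < u ξ)
    (hmin : CRSphere.IsLocalMinimizer k u)
    (hbal : ∀ j : Fin (n + 1),
      ∫ ξ, CRSphere.coord j ξ * ((u ξ ^ CRSphere.critExp n k : ℝ) : ℂ) ∂(CRSphere.vol n) = 0) :
    (∑ j : Fin (n + 1), CRSphere.commPairing k (CRSphere.coord j) (CRSphere.toC u)
        (fun ξ => star (CRSphere.coord j ξ) * (u ξ : ℂ))).im = 0 ∧
    (CRSphere.gjmsPairing k (CRSphere.toC u) (CRSphere.toC u)).im = 0 ∧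
    (∑ j : Fin (n + 1), CRSphere.commPairing k (CRSphere.coord j) (CRSphere.toC u)
        (fun ξ => star (CRSphere.coord j ξ) * (u ξ : ℂ))).re ≥
      (CRSphere.critExp n k - 2) *
        (CRSphere.gjmsPairing k (CRSphere.toC u) (CRSphere.toC u)).re := by
  refine proposition4p3_general (by lia) hkn hmin CRSphere.isSmooth_coord
    CRSphere.sum_norm_sq_coord fun j => (integral_congr_ae ?_).trans (hbal j)
  filter_upwards [hpos] with ξ hξ
  rw [abs_of_pos hξ]
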